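/- Let $k\ge 1$ be a fixed integer and let $p,q$ be fixed reals with $0<q\le p<1$. For $n\in\mathbb N$ let $G=G_n$ be the random block graph with $k$ balanced parts: its vertex set is a disjoint union $V_1\cup\dots\cup V_k$ with $|V_i|=\lfloor n/k\rfloor$ for $i<k$ and $\sum_i|V_i|=n$, and each pair of distinct vertices is an edge independently, with probability $p$ if both vertices lie in the same part and with probability $q$ if they lie in different parts. Put $p_{ii}=p$ and $p_{ij}=q$ for $i\neq j$, let $$g(\mathbf c,I)=\sum_{i\in I}c_i+\frac12\sum_{i,j\in I}c_ic_j\ln(1-p_{ij})\qquad(\mathbf c\in\mathbb R^k,\ I\subseteq\{1,\dots,k\}),$$ $$\mathcal A=\{\mathbf c\in\mathbb R_{\ge 0}^k:\ g(\mathbf c,I)\ge 0\text{ for all }\varnothing\ne I\subseteq\{1,\dots,k\}\},$$ and, with $\boldsymbol\alpha=(1/k,\dots,1/k)$ and $|\cdot|$ the $1$-norm, $$c^\star=\max\{|\mathbf c|:\ \mathbf c\in\operatorname{conv}(\mathcal A)\cap\{t\boldsymbol\alpha:\ t\ge 0\}\}.$$ Then $\mathcal A$ is convex, the maximum defining $c^\star$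 is attained, the vector $(c^\star/k,\dots,c^\star/k)$ lies in $\mathcal A$, and $$c^\star=\frac{-2}{\frac1k\ln(1-p)+\frac{k-1}{k}\ln(1-q)}.$$ Moreover, with high probability as $n\to\infty$, $$\chi(G_n)=(1+o(1))\frac{n}{c^\star\ln n}=(1+o(1))\,\frac{n}{2\ln n}\Big(-\frac1k\ln(1-p)-\frac{k-1}{k}\ln(1-q)\Big),$$ that is, for every $\varepsilon>0$ the probability that the ratio of $\chi(G_n)$ to the right-hand side (without the factor $1+o(1)$) lies in $[1-\varepsilon,1+\varepsilon]$ tends to $1$. -/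

import Mathlib

open Filter Topology MeasureTheory ProbabilityTheory unitInterval

noncomputable section

namespace BlockModel

variable {k : ℕ}

/-- The size of the `i`-th part of an `n`-element vertex set with part densities `α`:
`⌊α i * n⌋` for every part but the last one, which receives all the remaining vertices. -/
def partSize (α : Fin k → ℝ) (n : ℕ) (i : Fin k) : ℕ :=
  if (i : ℕ) + 1 = k then n - ∑ j ∈ Finset.univ.erase i, ⌊α j * n⌋₊ else ⌊α i * n⌋₊

/-- The vertex set: the disjoint union of the parts `V i`, `i : Fin k`, where `V i` has
`partSize α n i` elements. The part of a vertex `v` is `v.1`. -/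
abbrev Vertex (α : Fin k → ℝ) (n : ℕ) : Type := Σ i : Fin k, Fin (partSize α n i)

/-- The number of vertices is indeed `n`. -/
theorem card_vertex (hk : 1 ≤ k) (α : Fin k → ℝ) (hα : ∀ i, 0 ≤ α i) (hsum : ∑ i, α i = 1)
    (n : ℕ) : Fintype.card (Vertex α n) = n := by
  obtain ⟨m, rfl⟩ : ∃ m, k = m + 1 := ⟨k - 1, by omega⟩
  have hle : ∑ j ∈ Finset.univ.erase (Fin.last m), ⌊α j * n⌋₊ ≤ n := by
    have h1 : ((∑ j ∈ Finset.univ.erase (Fin.last m), ⌊α j * n⌋₊ : ℕ) : ℝ) ≤ n := by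
      push_cast
      calc ∑ j ∈ Finset.univ.erase (Fin.last m), (⌊α j * n⌋₊ : ℝ)
          ≤ ∑ j ∈ Finset.univ.erase (Fin.last m), α j * n :=
            Finset.sum_le_sum fun j _ => Nat.floor_le (mul_nonneg (hα j) n.cast_nonneg)
        _ ≤ ∑ j, α j * n :=
            Finset.sum_le_sum_of_subset_of_nonneg (Finset.erase_subset _ _)
              fun j _ _ => mul_nonneg (hα j) n.cast_nonneg
        _ = n := by rw [← Finset.sum_mul, hsum, one_mul]
    exact_mod_cast h1
  have hrest : ∑ j ∈ Finset.univ.erase (Fin.last m), partSize α n j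
      = ∑ j ∈ Finset.univ.erase (Fin.last m), ⌊α j * n⌋₊ := by
    refine Finset.sum_congr rfl fun j hj => ?_
    have hj' : (j : ℕ) ≠ m := fun h => (Finset.ne_of_mem_erase hj) (Fin.ext (by simpa using h))
    simp [partSize, hj']
  have hlast : partSize α n (Fin.last m)
      = n - ∑ j ∈ Finset.univ.erase (Fin.last m), ⌊α j * n⌋₊ := by
    simp [partSize]
  simp only [Vertex, Fintype.card_sigma, Fintype.card_fin]
  rw [← Finset.add_sum_erase _ _ (Finset.mem_univ (Fin.last m)), hrest, hlast]
  omega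

/-- The probability with which an unordered pair of vertices is an edge: it is `P i j` for a
vertex of part `i` and a vertex of part `j`. -/
def edgeProb (α : Fin k → ℝ) (P : Matrix (Fin k) (Fin k) I) (hP : P.IsSymm) (n : ℕ) :
    Sym2 (Vertex α n) → I :=
  Sym2.lift ⟨fun u v => P u.1 v.1, fun u v => hP.apply v.1 u.1⟩

/-- The law of the random block graph `G(n, α, P)`. Every unordered pair `e` of vertices is
selected independently with probability `edgeProb α P hP n e`, and the edges are the selected
pairs of two distinct vertices (`SimpleGraph.fromEdgeSet` ignores the diagonal). -/
def randomBlockGraph (α : Fin k → ℝ) (P : Matrix (Fin k) (Fin k) I) (hP : P.IsSymm) (n : ℕ) :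
    Measure (SimpleGraph (Vertex α n)) :=
  (Measure.pi fun e : Sym2 (Vertex α n) => bernoulliMeasure True False (edgeProb α P hP n e)).map
    fun ω => SimpleGraph.fromEdgeSet {e | ω e}

theorem measurable_fromEdgeSet_setOf (V : Type*) :
    Measurable fun ω : Sym2 V → Prop => SimpleGraph.fromEdgeSet {e | ω e} := by
  rw [SimpleGraph.measurable_iff_adj]
  intro u v
  simp only [SimpleGraph.fromEdgeSet_adj]
  exact (measurable_pi_apply _).and measurable_const

instance (α : Fin k → ℝ) (P : Matrix (Fin k) (Fin k) I) (hP : P.IsSymm) (n : ℕ) :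
    IsProbabilityMeasure (randomBlockGraph α P hP n) :=
  Measure.isProbabilityMeasure_map (measurable_fromEdgeSet_setOf _).aemeasurable

/-- `g(c, J) = ∑_{i ∈ J} c_i + (1/2) ∑_{i, j ∈ J} c_i c_j ln (1 - p_{ij})`, where the double sum
runs over all ordered pairs. -/
def g (P : Matrix (Fin k) (Fin k) I) (c : Fin k → ℝ) (J : Finset (Fin k)) : ℝ :=
  ∑ i ∈ J, c i + 1 / 2 * ∑ i ∈ J, ∑ j ∈ J, c i * c j * Real.log (1 - (P i j : ℝ))

/-- The set `𝓐` of admissible types. -/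
def admissible (P : Matrix (Fin k) (Fin k) I) : Set (Fin k → ℝ) :=
  {c | (∀ i, 0 ≤ c i) ∧ ∀ J : Finset (Fin k), J.Nonempty → 0 ≤ g P c J}

/-- The set `{|c| : c ∈ conv(𝓐) ∩ {t α : t ≥ 0}}`, with the norm `|c| = ∑ i, |c i|`. -/
def admissibleNorms (α : Fin k → ℝ) (P : Matrix (Fin k) (Fin k) I) : Set ℝ :=
  (fun c : Fin k → ℝ => ∑ i, |c i|) ''
    (convexHull ℝ (admissible P) ∩ {c | ∃ t : ℝ, 0 ≤ t ∧ c = t • α})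

/-- The constant `c⋆(α, P)`, the maximum of `admissibleNorms α P`. -/
def cStar (α : Fin k → ℝ) (P : Matrix (Fin k) (Fin k) I) : ℝ :=
  sSup (admissibleNorms α P)

/-- With high probability `χ(G) = (1 + o(1)) f(n)` for `G ~ G(n, α, P)`: for every `ε > 0`, the
probability that `|χ(G) - f(n)| ≤ ε |f(n)|` tends to `1` as `n → ∞`. -/
def ChromaticNumberAsymp (α : Fin k → ℝ) (P : Matrix (Fin k) (Fin k) I) (hP : P.IsSymm)
    (f : ℕ → ℝ) : Prop :=
  ∀ ε : ℝ, 0 < ε →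
    Tendsto (fun n : ℕ => randomBlockGraph α P hP n
      {G | |(G.chromaticNumber.toNat : ℝ) - f n| ≤ ε * |f n|}) atTop (𝓝 1)

/-- Equal part densities `1 / k`. -/
def balanced (k : ℕ) : Fin k → ℝ := fun _ => 1 / (k : ℝ)

/-- The matrix with diagonal entries `p` and off-diagonal entries `q`. -/
def homogeneous (k : ℕ) (p q : I) : Matrix (Fin k) (Fin k) I :=
  Matrix.of fun i j => if i = j then p else q

theorem homogeneous_isSymm (k : ℕ) (p q : I) : (homogeneous k p q).IsSymm := by
  ext i j
  simp [homogeneous, eq_comm]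

end BlockModel

end

/-! Write `L = log n`, `a = -log (1 - p)`, `b = -log (1 - q)` and `κ = (a + (k - 1) * b) / k`, so
that `c⋆ = 2 / κ`. Up to a diagonal correction, a vertex set is independent with probability `exp
(-energy / 2)`, where the energy is the quadratic form `(a - b) * ∑ s_i ^ 2 + b * s ^ 2` in its part
sizes `s_i` and its size `s`.

Lower bound: a first moment over all vertex sets shows that with high probability every independent
`S` satisfies `energy / 2 ≤ L * |S| + O(L ^ 2)` (`pr_exists_high_energy_le`). By Cauchy–Schwarz the
classes of an `m`-colouring have total energy at least `n ^ 2 * κ / m` (`sq_card_le_of_coloring`),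
which forces `m ≥ (1 - o(1)) * n * κ / (2 * L)`.

Upper bound: with high probability every `U` with `w * ℓ` vertices in each part, a number of order
`n / L ^ 2`, contains an independent set with `ℓ ≈ c⋆ * L / k` vertices in each part. For a fixed
`U` this fails with probability at most `e ^ (-n)`, by the extended Janson inequality for
transversals of `k * ℓ` cells of size `w` (`pr_no_transversal_le`), and this beats the `2 ^ n`
choices of `U`. Removing such sets greedily leaves `o(n / L)` vertices, which receive private
colours.

The constant: `a ≥ b ≥ 0` makes each `g(·, J)` a linear function minus a positive semidefinite form,
hence concave. So `𝓐` is convex and equals its hull, and on the ray of `balanced k` the tightest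
constraint is `J = univ`. -/

noncomputable section

/-! ### Random subsets of a finite set with independent elements. -/

namespace RandomSubset

open Finset
open scoped Classical

variable {E : Type*} [Fintype E]

/-- The weight of `R` under the law of the random subset of `E` that contains each `e`
independently with probability `r e`. -/
def weight (r : E → ℝ) (R : Finset E) : ℝ := (∏ e ∈ R, r e) * ∏ e ∈ Rᶜ, (1 - r e)

/-- The probability that the random subset satisfies `P`. -/
def pr (r : E → ℝ) (P : Finset E → Prop) : ℝ := ∑ R, if P R then weight r R else 0

theorem weight_nonneg {r : E → ℝ} (h0 : ∀ e, 0 ≤ r e) (h1 : ∀ e, r e ≤ 1) (R : Finset E) :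
    0 ≤ weight r R :=
  mul_nonneg (prod_nonneg fun e _ => h0 e) (prod_nonneg fun e _ => sub_nonneg.2 (h1 e))

theorem pr_true (r : E → ℝ) : pr r (fun _ => True) = 1 := by
  have h := prod_add r (fun e => 1 - r e) (univ : Finset E)
  simp only [add_sub_cancel, prod_const_one, powerset_univ, ← compl_eq_univ_sdiff] at h
  simpa only [pr, if_true, weight] using h.symm

theorem pr_mono {r : E → ℝ} (h0 : ∀ e, 0 ≤ r e) (h1 : ∀ e, r e ≤ 1) {P Q : Finset E → Prop}
    (h : ∀ R, P R → Q R) : pr r P ≤ pr r Q := by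
  refine sum_le_sum fun R _ => ?_
  by_cases hP : P R
  · simp [hP, h R hP]
  · simp only [hP, if_false]
    split_ifs
    exacts [weight_nonneg h0 h1 R, le_rfl]

theorem pr_nonneg {r : E → ℝ} (h0 : ∀ e, 0 ≤ r e) (h1 : ∀ e, r e ≤ 1) (P : Finset E → Prop) :
    0 ≤ pr r P :=
  sum_nonneg fun R _ => by split_ifs; exacts [weight_nonneg h0 h1 R, le_rfl]

theorem pr_le_sum {r : E → ℝ} (h0 : ∀ e, 0 ≤ r e) (h1 : ∀ e, r e ≤ 1) {ι : Type*}
    (s : Finset ι) {P : Finset E → Prop} {Q : ι → Finset E → Prop}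
    (h : ∀ R, P R → ∃ i ∈ s, Q i R) : pr r P ≤ ∑ i ∈ s, pr r (Q i) := by
  unfold pr
  rw [sum_comm]
  refine sum_le_sum fun R _ => ?_
  have hnn : ∀ i ∈ s, 0 ≤ if Q i R then weight r R else 0 := fun i _ => by
    split_ifs; exacts [weight_nonneg h0 h1 R, le_rfl]
  split_ifs with hP
  · obtain ⟨i, hi, hQ⟩ := h R hP
    calc weight r R = if Q i R then weight r R else 0 := by simp [hQ]
      _ ≤ _ := single_le_sum hnn hi
  · exact sum_nonneg hnn

theorem pr_and_add_pr_and_not (r : E → ℝ) (P Q : Finset E → Prop) :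
    pr r (fun R => Q R ∧ P R) + pr r (fun R => ¬ Q R ∧ P R) = pr r P := by
  unfold pr
  rw [← sum_add_distrib]
  refine sum_congr rfl fun R _ => ?_
  by_cases hP : P R <;> by_cases hQ : Q R <;> simp [hP, hQ]

/-- Each `R` avoiding `a` is paired with `insert a R`; their weights share all factors except `1 - r
a` and `r a`. -/
theorem pr_mem_and (r : E → ℝ) (a : E) (P : Finset E → Prop) :
    pr r (fun R => a ∈ R ∧ P R) = r a * pr r (fun R => P (insert a R)) := by
  have ha : a ∉ (univ : Finset E).erase a := by simp
  have key : ∀ F : Finset E → ℝ, ∑ R, F R =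
      ∑ R ∈ ((univ : Finset E).erase a).powerset, (F R + F (insert a R)) := by
    intro F
    rw [sum_add_distrib, ← sum_powerset_insert ha, insert_erase (mem_univ a), powerset_univ]
  unfold pr
  rw [key, key, mul_sum]
  refine sum_congr rfl fun R hR => ?_
  have haR : a ∉ R := fun h => by simpa using mem_powerset.1 hR h
  have haC : a ∈ Rᶜ := by simpa using haR
  have hC : (insert a R)ᶜ = Rᶜ.erase a := by ext; simp
  have e1 : weight r (insert a R) = r a * ((∏ e ∈ R, r e) * ∏ e ∈ Rᶜ.erase a, (1 - r e)) := by
    rw [weight, prod_insert haR, hC]; ring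
  have e2 : weight r R = (1 - r a) * ((∏ e ∈ R, r e) * ∏ e ∈ Rᶜ.erase a, (1 - r e)) := by
    rw [weight, ← mul_prod_erase _ _ haC]; ring
  simp only [haR, false_and, if_false, mem_insert_self, true_and, insert_idem, e1, e2]
  split_ifs <;> ring

/-- Conditioned on `A ⊆ R`, the random set is distributed as `R ∪ A`. -/
theorem pr_subset_and (r : E → ℝ) (A : Finset E) (P : Finset E → Prop) :
    pr r (fun R => A ⊆ R ∧ P R) = (∏ e ∈ A, r e) * pr r (fun R => P (R ∪ A)) := by
  induction A using Finset.induction_on generalizing P with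
  | empty => simp
  | insert a A ha ih =>
    have h1 : pr r (fun R => insert a A ⊆ R ∧ P R) = pr r (fun R => A ⊆ R ∧ (a ∈ R ∧ P R)) := by
      congr 1; funext R; rw [insert_subset_iff]; exact propext (by tauto)
    have h2 : (fun R : Finset E => a ∈ R ∪ A ∧ P (R ∪ A)) = fun R => a ∈ R ∧ P (R ∪ A) := by
      funext R; simp [ha]
    rw [h1, ih, h2, pr_mem_and, prod_insert ha]
    simp only [insert_union, union_insert]
    ring

theorem pr_subset (r : E → ℝ) (A : Finset E) : pr r (fun R => A ⊆ R) = ∏ e ∈ A, r e := by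
  simpa [pr_true] using pr_subset_and r A fun _ => True

/-! ### Janson's inequality and its extended form. -/

section Janson

variable {ι : Type*} (A : ι → Finset E) (r : E → ℝ)

/-- The probability that the random subset contains both `A i` and `A j`, if these are two
dependent events. -/
def corr (i j : ι) : ℝ := if i ≠ j ∧ ¬ Disjoint (A i) (A j) then ∏ e ∈ A i ∪ A j, r e else 0

omit [Fintype E] in
theorem corr_comm (i j : ι) : corr A r i j = corr A r j i := by
  simp only [corr, ne_comm (a := i), disjoint_comm (a := A i), union_comm (A i)]

variable {r} (h0 : ∀ e, 0 ≤ r e) (h1 : ∀ e, r e ≤ 1)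
include h0 h1

/-- The inductive step of Janson's inequality. The event `A a ⊆ R` is independent of avoiding those
`A i` that are disjoint from `A a` (the event `N`). The remaining `A j` are removed by a union
bound, and each costs at most `corr A r a j * pr r N`, because `N` is a decreasing event. -/
theorem pr_avoid_and_ge (S : Finset ι) (a : ι) (ha : a ∉ S) :
    pr r (fun R => ∀ i ∈ S, ¬ A i ⊆ R) * (∏ e ∈ A a, r e - ∑ j ∈ S, corr A r a j) ≤
      pr r (fun R => A a ⊆ R ∧ ∀ i ∈ S, ¬ A i ⊆ R) := by
  set F := pr r fun R => ∀ i ∈ S, ¬ A i ⊆ R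
  rcases le_total (∏ e ∈ A a, r e - ∑ j ∈ S, corr A r a j) 0 with hneg | hpos
  · exact (mul_nonpos_of_nonneg_of_nonpos (pr_nonneg h0 h1 _) hneg).trans (pr_nonneg h0 h1 _)
  let S' := S.filter fun i => Disjoint (A a) (A i)
  let N : Finset E → Prop := fun R => ∀ i ∈ S', ¬ A i ⊆ R
  have hFN : F ≤ pr r N := pr_mono h0 h1 fun R hR i hi => hR i (mem_filter.1 hi).1
  have hind : pr r (fun R => A a ⊆ R ∧ N R) = (∏ e ∈ A a, r e) * pr r N := by
    rw [pr_subset_and]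
    congr 2
    funext R
    refine propext (forall₂_congr fun i hi => not_congr
      ⟨fun h => ?_, fun h => h.trans subset_union_left⟩)
    exact (mem_filter.1 hi).2.symm.left_le_of_le_sup_right h
  have hsplit : pr r (fun R => A a ⊆ R ∧ N R) ≤
      pr r (fun R => A a ⊆ R ∧ ∀ i ∈ S, ¬ A i ⊆ R) + ∑ j ∈ S, corr A r a j * pr r N := by
    rw [← pr_and_add_pr_and_not r (fun R => A a ⊆ R ∧ N R) (fun R => ∀ i ∈ S, ¬ A i ⊆ R)]
    refine add_le_add (pr_mono h0 h1 fun R hR => ⟨hR.2.1, hR.1⟩) ?_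
    have hle : ∀ j ∈ S, j ∉ S' → pr r (fun R => A a ∪ A j ⊆ R ∧ N R) ≤ corr A r a j * pr r N := by
      intro j hj hj'
      have hd : a ≠ j ∧ ¬ Disjoint (A a) (A j) :=
        ⟨fun h => ha (h ▸ hj), fun h => hj' (mem_filter.2 ⟨hj, h⟩)⟩
      rw [pr_subset_and, corr, if_pos hd]
      exact mul_le_mul_of_nonneg_left
        (pr_mono h0 h1 fun R hR i hi h => hR i hi (h.trans subset_union_left))
        (prod_nonneg fun e _ => h0 e)
    calc pr r (fun R => ¬ (∀ i ∈ S, ¬ A i ⊆ R) ∧ A a ⊆ R ∧ N R)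
        ≤ ∑ j ∈ S \ S', pr r (fun R => A a ∪ A j ⊆ R ∧ N R) := by
          refine pr_le_sum h0 h1 _ fun R hR => ?_
          obtain ⟨hex, haR, hN⟩ := hR
          push Not at hex
          obtain ⟨j, hj, hjR⟩ := hex
          exact ⟨j, mem_sdiff.2 ⟨hj, fun h => hN j h hjR⟩, union_subset haR hjR, hN⟩
      _ ≤ ∑ j ∈ S \ S', corr A r a j * pr r N :=
          sum_le_sum fun j hj => hle j (mem_sdiff.1 hj).1 (mem_sdiff.1 hj).2
      _ ≤ ∑ j ∈ S, corr A r a j * pr r N := by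
          refine sum_le_sum_of_subset_of_nonneg sdiff_subset fun j _ _ => ?_
          refine mul_nonneg ?_ (pr_nonneg h0 h1 _)
          unfold corr
          split_ifs
          exacts [prod_nonneg fun e _ => h0 e, le_rfl]
  rw [hind, ← sum_mul] at hsplit
  calc F * (∏ e ∈ A a, r e - ∑ j ∈ S, corr A r a j)
      ≤ pr r N * (∏ e ∈ A a, r e - ∑ j ∈ S, corr A r a j) := mul_le_mul_of_nonneg_right hFN hpos
    _ ≤ _ := by linarith

/-- Janson's inequality. -/
theorem pr_avoid_le_exp (S : Finset ι) :
    pr r (fun R => ∀ i ∈ S, ¬ A i ⊆ R) ≤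
      Real.exp (-∑ i ∈ S, ∏ e ∈ A i, r e + (∑ i ∈ S, ∑ j ∈ S, corr A r i j) / 2) := by
  induction S using Finset.induction_on with
  | empty => simp [pr_true]
  | insert a S ha ih =>
    have hstep := pr_avoid_and_ge A h0 h1 S a ha
    have hsum := pr_and_add_pr_and_not r (fun R => ∀ i ∈ S, ¬ A i ⊆ R) (fun R => A a ⊆ R)
    have hEq : pr r (fun R => ∀ i ∈ insert a S, ¬ A i ⊆ R) =
        pr r (fun R => ¬ A a ⊆ R ∧ ∀ i ∈ S, ¬ A i ⊆ R) := by
      simp only [forall_mem_insert]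
    have hdiag : corr A r a a = 0 := by simp [corr]
    have hexp : -∑ i ∈ insert a S, ∏ e ∈ A i, r e +
        (∑ i ∈ insert a S, ∑ j ∈ insert a S, corr A r i j) / 2 =
        (-∑ i ∈ S, ∏ e ∈ A i, r e + (∑ i ∈ S, ∑ j ∈ S, corr A r i j) / 2) +
          -(∏ e ∈ A a, r e - ∑ j ∈ S, corr A r a j) := by
      simp only [sum_insert ha, sum_add_distrib, hdiag]
      rw [sum_congr rfl fun i _ => corr_comm A r i a]
      ring
    rw [hEq, hexp, Real.exp_add]
    set x := ∏ e ∈ A a, r e - ∑ j ∈ S, corr A r a j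
    set F := pr r fun R => ∀ i ∈ S, ¬ A i ⊆ R
    have hF : 0 ≤ F := pr_nonneg h0 h1 _
    calc pr r (fun R => ¬ A a ⊆ R ∧ ∀ i ∈ S, ¬ A i ⊆ R) ≤ F * (1 - x) := by linarith
      _ ≤ F * Real.exp (-x) :=
          mul_le_mul_of_nonneg_left (by linarith [Real.add_one_le_exp (-x)]) hF
      _ ≤ _ := mul_le_mul_of_nonneg_right ih (Real.exp_pos _).le

-- Averaging over a random `S` of density `t`: an element is kept with probability `t` and a pair of
-- distinct elements with probability `t ^ 2`. The right side is the mean, so some `S` does not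
-- exceed it.
omit h0 h1 in
theorem exists_subset_quadratic_le [Fintype ι] (m : ι → ℝ) (d : ι → ι → ℝ) (hd : ∀ i, d i i = 0)
    {t : ℝ} (ht0 : 0 ≤ t) (ht1 : t ≤ 1) :
    ∃ S : Finset ι, -∑ i ∈ S, m i + (∑ i ∈ S, ∑ j ∈ S, d i j) / 2 ≤
      -(t * ∑ i, m i) + t ^ 2 * (∑ i, ∑ j, d i j) / 2 := by
  by_contra! hcon
  set c := -(t * ∑ i, m i) + t ^ 2 * (∑ i, ∑ j, d i j) / 2 with hc
  let w : Finset ι → ℝ := weight fun _ : ι => t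
  have hw : ∀ S, 0 ≤ w S := weight_nonneg (fun _ => ht0) fun _ => ht1
  have hw1 : ∑ S, w S = 1 := by simpa [pr] using pr_true fun _ : ι => t
  have hm : ∑ S, w S * ∑ i ∈ S, m i = t * ∑ i, m i := by
    have : ∀ i, ∑ S, (if i ∈ S then w S else 0) = t := fun i => by
      have := pr_subset (fun _ : ι => t) {i}
      simpa [pr] using this
    calc ∑ S, w S * ∑ i ∈ S, m i = ∑ S, ∑ i, (if i ∈ S then w S else 0) * m i := by
          refine sum_congr rfl fun S _ => ?_
          simp [mul_sum, ite_mul]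
      _ = t * ∑ i, m i := by
          rw [sum_comm, mul_sum]
          exact sum_congr rfl fun i _ => by rw [← sum_mul, this]
  have hdd : ∑ S, w S * (∑ i ∈ S, ∑ j ∈ S, d i j) = t ^ 2 * ∑ i, ∑ j, d i j := by
    have : ∀ i j, (∑ S, if i ∈ S ∧ j ∈ S then w S else 0) * d i j = t ^ 2 * d i j := fun i j => by
      rcases eq_or_ne i j with rfl | hij
      · simp [hd]
      · have := pr_subset (fun _ : ι => t) {i, j}
        simp only [pr, insert_subset_iff, singleton_subset_iff, prod_const, card_pair hij] at this
        rw [← this]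
    calc ∑ S, w S * (∑ i ∈ S, ∑ j ∈ S, d i j)
        = ∑ S, ∑ i, ∑ j, (if i ∈ S ∧ j ∈ S then w S else 0) * d i j := by
          refine sum_congr rfl fun S _ => ?_
          simp [mul_sum, ite_mul, ite_and]
      _ = t ^ 2 * ∑ i, ∑ j, d i j := by
          rw [sum_comm, mul_sum]
          refine sum_congr rfl fun i _ => ?_
          rw [sum_comm, mul_sum]
          exact sum_congr rfl fun j _ => by rw [← sum_mul, this]
  have hlt : ∑ S, w S * c < ∑ S, w S * (-∑ i ∈ S, m i + (∑ i ∈ S, ∑ j ∈ S, d i j) / 2) := by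
    refine sum_lt_sum (fun S _ => mul_le_mul_of_nonneg_left (hcon S).le (hw S)) ?_
    obtain ⟨S, hS⟩ : ∃ S, w S ≠ 0 := by
      by_contra! h
      simp [h] at hw1
    exact ⟨S, mem_univ _, mul_lt_mul_of_pos_left (hcon S) ((hw S).lt_of_ne' hS)⟩
  rw [← sum_mul, hw1, one_mul] at hlt
  have : ∑ S, w S * (-∑ i ∈ S, m i + (∑ i ∈ S, ∑ j ∈ S, d i j) / 2) = c := by
    simp_rw [mul_add, sum_add_distrib, mul_neg, sum_neg_distrib, ← mul_div_assoc, ← sum_div]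
    rw [hm, hdd, hc]
  linarith

/-- The extended form of Janson's inequality. -/
theorem pr_avoid_le_exp_sq_div [Fintype ι] {D : ℝ} (hD0 : 0 < D)
    (hμ : ∑ i, ∏ e ∈ A i, r e ≤ D) (hΔ : ∑ i, ∑ j, corr A r i j ≤ D) :
    pr r (fun R => ∀ i, ¬ A i ⊆ R) ≤ Real.exp (-(∑ i, ∏ e ∈ A i, r e) ^ 2 / (2 * D)) := by
  set μ := ∑ i, ∏ e ∈ A i, r e with hμdef
  have hμ0 : 0 ≤ μ := sum_nonneg fun i _ => prod_nonneg fun e _ => h0 e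
  -- `t = μ / D` minimises `-t * μ + t ^ 2 * D / 2`, with minimum `-μ ^ 2 / (2 * D)`; the assumption
  -- `μ ≤ D` makes it a valid density.
  obtain ⟨S, hS⟩ := exists_subset_quadratic_le (fun i => ∏ e ∈ A i, r e) (corr A r)
    (fun i => by simp [corr]) (t := μ / D) (by positivity) ((div_le_one hD0).2 hμ)
  refine (pr_mono h0 h1 fun R hR i (_ : i ∈ S) => hR i).trans
    ((pr_avoid_le_exp A h0 h1 S).trans (Real.exp_le_exp.2 (hS.trans ?_)))
  have : (μ / D) ^ 2 * (∑ i, ∑ j, corr A r i j) / 2 ≤ (μ / D) ^ 2 * D / 2 := by gcongr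
  refine (add_le_add_right this _).trans (le_of_eq ?_)
  rw [← hμdef]
  field_simp
  ring

end Janson

end RandomSubset

end

noncomputable section

/-! ### From the product measure to sums over sets of non-edges. -/

namespace BlockModel

open scoped Classical

open RandomSubset

/-- The graph on `V` whose set of non-edges is `R`. -/
def graphOfNonedges {V : Type*} (R : Finset (Sym2 V)) : SimpleGraph V :=
  SimpleGraph.fromEdgeSet {e | e ∉ R}

variable {k : ℕ}

/-- The probability that an unordered pair of vertices is not an edge. -/
def nonedgeProb (α : Fin k → ℝ) (P : Matrix (Fin k) (Fin k) I) (hP : P.IsSymm) (n : ℕ)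
    (e : Sym2 (Vertex α n)) : ℝ := 1 - (edgeProb α P hP n e : ℝ)

theorem nonedgeProb_nonneg (α : Fin k → ℝ) (P : Matrix (Fin k) (Fin k) I) (hP : P.IsSymm) (n : ℕ)
    (e : Sym2 (Vertex α n)) : 0 ≤ nonedgeProb α P hP n e :=
  sub_nonneg.2 (edgeProb α P hP n e).2.2

theorem nonedgeProb_le_one (α : Fin k → ℝ) (P : Matrix (Fin k) (Fin k) I) (hP : P.IsSymm) (n : ℕ)
    (e : Sym2 (Vertex α n)) : nonedgeProb α P hP n e ≤ 1 :=
  sub_le_self _ (edgeProb α P hP n e).2.1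

/-- The random subset consists of the non-edges, so that independence of `S` becomes the containment
`pairs S ⊆ R` required by Janson's inequality. Diagonal pairs are drawn as well, without effect on
the graph. -/
theorem pi_bernoulli_singleton (α : Fin k → ℝ) (P : Matrix (Fin k) (Fin k) I) (hP : P.IsSymm)
    (n : ℕ) (R : Finset (Sym2 (Vertex α n))) :
    (Measure.pi fun e : Sym2 (Vertex α n) => bernoulliMeasure True False (edgeProb α P hP n e))
      {fun e => e ∉ R} = ENNReal.ofReal (weight (nonedgeProb α P hP n) R) := by
  have hr : ∀ e, (bernoulliMeasure True False (edgeProb α P hP n e)) {e ∉ R} =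
      ENNReal.ofReal (if e ∈ R then nonedgeProb α P hP n e else 1 - nonedgeProb α P hP n e) := by
    intro e
    rw [bernoulliMeasure_apply _ (MeasurableSet.singleton _)]
    by_cases h : e ∈ R
    · have : unitInterval.toNNReal (σ (edgeProb α P hP n e)) =
          Real.toNNReal (1 - edgeProb α P hP n e) := by
        ext; simp [sub_nonneg.2 (edgeProb α P hP n e).2.2]
      simp [h, nonedgeProb, ENNReal.ofReal, this]
    · have : unitInterval.toNNReal (edgeProb α P hP n e) =
          Real.toNNReal (edgeProb α P hP n e) := by
        ext; simp [(edgeProb α P hP n e).2.1]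
      simp [h, nonedgeProb, ENNReal.ofReal, this]
  rw [Measure.pi_singleton]
  simp only [hr]
  rw [← ENNReal.ofReal_prod_of_nonneg]
  · congr 1
    rw [weight, Finset.prod_ite]
    congr 1
    · congr 1; ext; simp
    · congr 1; ext; simp
  · intro e _
    split_ifs
    exacts [nonedgeProb_nonneg α P hP n e, sub_nonneg.2 (nonedgeProb_le_one α P hP n e)]

/-- The random block graph has a property with at least the probability that is left by the sets
of non-edges for which it fails. -/
theorem one_sub_pr_le_randomBlockGraph (α : Fin k → ℝ) (P : Matrix (Fin k) (Fin k) I)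
    (hP : P.IsSymm) (n : ℕ) (Q : SimpleGraph (Vertex α n) → Prop) :
    ENNReal.ofReal (1 - pr (nonedgeProb α P hP n) fun R => ¬ Q (graphOfNonedges R)) ≤
      randomBlockGraph α P hP n {G | Q G} := by
  set r := nonedgeProb α P hP n
  have hr0 : ∀ e, 0 ≤ r e := nonedgeProb_nonneg α P hP n
  have hr1 : ∀ e, r e ≤ 1 := nonedgeProb_le_one α P hP n
  have hsplit := pr_and_add_pr_and_not r (fun _ => True) fun R => Q (graphOfNonedges R)
  simp only [and_true, pr_true] at hsplit
  rw [← hsplit, add_sub_cancel_right]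
  -- This inequality holds for arbitrary sets, so no measurability of `Q` is needed.
  refine le_trans ?_ (Measure.le_map_apply (measurable_fromEdgeSet_setOf _).aemeasurable _)
  set μ := Measure.pi fun e : Sym2 (Vertex α n) =>
    bernoulliMeasure True False (edgeProb α P hP n e)
  let f : Finset (Sym2 (Vertex α n)) → Sym2 (Vertex α n) → Prop := fun R e => e ∉ R
  have hf : Function.Injective f := fun R R' h => by
    ext e
    simpa [f] using not_iff_not.2 (iff_of_eq (congrFun h e))
  let s : Finset (Finset (Sym2 (Vertex α n))) :=
    Finset.univ.filter fun R => Q (graphOfNonedges R)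
  calc ENNReal.ofReal (pr r fun R => Q (graphOfNonedges R))
      = ∑ R ∈ s, μ {f R} := by
        rw [pr, ← Finset.sum_filter,
          ENNReal.ofReal_sum_of_nonneg fun R _ => weight_nonneg hr0 hr1 R]
        exact Finset.sum_congr rfl fun R _ => (pi_bernoulli_singleton α P hP n R).symm
    _ = ∑ ω ∈ s.map ⟨f, hf⟩, μ {ω} := by simp
    _ = μ (s.map ⟨f, hf⟩ : Finset _) := sum_measure_singleton
    _ ≤ _ := by
        refine measure_mono fun ω hω => ?_
        obtain ⟨R, hR, rfl⟩ := Finset.mem_map.1 (Finset.mem_coe.1 hω)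
        exact (Finset.mem_filter.1 hR).2

theorem tendsto_randomBlockGraph_of_pr (α : Fin k → ℝ) (P : Matrix (Fin k) (Fin k) I)
    (hP : P.IsSymm) (Q : ∀ n, SimpleGraph (Vertex α n) → Prop) (u : ℕ → ℝ)
    (hu : Tendsto u atTop (𝓝 0))
    (h : ∀ᶠ n in atTop, (pr (nonedgeProb α P hP n) fun R => ¬ Q n (graphOfNonedges R)) ≤ u n) :
    Tendsto (fun n => randomBlockGraph α P hP n {G | Q n G}) atTop (𝓝 1) := by
  have hlim : Tendsto (fun n => ENNReal.ofReal (1 - u n)) atTop (𝓝 1) := by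
    have := ENNReal.tendsto_ofReal (hu.const_sub 1)
    simpa using this
  refine tendsto_of_tendsto_of_tendsto_of_le_of_le' hlim tendsto_const_nhds ?_
    (Eventually.of_forall fun n => prob_le_one)
  filter_upwards [h] with n hn
  exact (ENNReal.ofReal_le_ofReal (by linarith)).trans
    (one_sub_pr_le_randomBlockGraph α P hP n (Q n))

/-! ### Energy of vertex sets and the lower bound on the number of colours. -/

section Pairs

variable {V : Type*}

/-- The unordered pairs of distinct elements of `S`. -/
def pairs (S : Finset V) : Finset (Sym2 V) := S.sym2.filter fun e => ¬ e.IsDiag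

theorem mk_mem_pairs {S : Finset V} {u v : V} : s(u, v) ∈ pairs S ↔ u ∈ S ∧ v ∈ S ∧ u ≠ v := by
  simp [pairs, and_assoc]

theorem pairs_insert {S : Finset V} {a : V} (ha : a ∉ S) :
    pairs (insert a S) = pairs S ∪ S.image fun b => s(a, b) := by
  ext e
  induction e with
  | _ u v =>
    simp only [Finset.mem_union, mk_mem_pairs, Finset.mem_insert, Finset.mem_image, Sym2.eq_iff]
    grind

theorem sum_pairs_insert {S : Finset V} {a : V} (ha : a ∉ S) (f : Sym2 V → ℝ) :
    ∑ e ∈ pairs (insert a S), f e = ∑ e ∈ pairs S, f e + ∑ b ∈ S, f s(a, b) := by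
  rw [pairs_insert ha, Finset.sum_union, Finset.sum_image]
  · intro b _ c _ h
    exact Sym2.congr_right.1 h
  · rw [Finset.disjoint_left]
    intro e he he'
    obtain ⟨b, -, rfl⟩ := Finset.mem_image.1 he'
    exact ha (mk_mem_pairs.1 he).1

theorem sum_sum_eq_two_mul_sum_pairs (S : Finset V) (f : Sym2 V → ℝ) :
    ∑ u ∈ S, ∑ v ∈ S, f s(u, v) = 2 * ∑ e ∈ pairs S, f e + ∑ v ∈ S, f s(v, v) := by
  induction S using Finset.induction_on with
  | empty => simp [pairs]
  | insert a S ha ih =>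
    rw [sum_pairs_insert ha]
    simp only [Finset.sum_insert ha, Finset.sum_add_distrib, ih]
    rw [Finset.sum_congr rfl fun u _ => congrArg f (Sym2.eq_swap (a := u) (b := a))]
    ring

variable {k : ℕ} (part : V → Fin k) (a b : ℝ)

/-- The cost `a` of a pair within a part, and `b` of a pair of vertices in different parts. -/
def cost (u v : V) : ℝ := if part u = part v then a else b

/-- The total cost of all ordered pairs in `S`. -/
def energy (S : Finset V) : ℝ := ∑ u ∈ S, ∑ v ∈ S, cost part a b u v

/-- For `0 ≤ b ≤ a` both coefficients are nonnegative, which is what allows Cauchy–Schwarz on each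
sum of squares. -/
theorem energy_eq (S : Finset V) : energy part a b S =
    (a - b) * ∑ i, ((S.filter fun v => part v = i).card : ℝ) ^ 2 + b * (S.card : ℝ) ^ 2 := by
  have h1 : ∑ i, ((S.filter fun v => part v = i).card : ℝ) ^ 2 =
      ∑ u ∈ S, ∑ v ∈ S, if part u = part v then (1 : ℝ) else 0 := by
    have : ∀ i, ((S.filter fun v => part v = i).card : ℝ) ^ 2 =
        ∑ u ∈ S, ∑ v ∈ S, (if part u = i then (1 : ℝ) else 0) * (if part v = i then 1 else 0) := by
      intro i
      rw [← Finset.sum_mul_sum, Finset.sum_boole, sq]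
    simp_rw [this]
    rw [Finset.sum_comm]
    refine Finset.sum_congr rfl fun u _ => ?_
    rw [Finset.sum_comm]
    refine Finset.sum_congr rfl fun v _ => ?_
    simp [eq_comm]
  have h2 : (S.card : ℝ) ^ 2 = ∑ u ∈ S, ∑ v ∈ S, (1 : ℝ) := by simp [sq]
  rw [h1, h2, Finset.mul_sum, Finset.mul_sum, ← Finset.sum_add_distrib]
  refine Finset.sum_congr rfl fun u _ => ?_
  rw [Finset.mul_sum, Finset.mul_sum, ← Finset.sum_add_distrib]
  refine Finset.sum_congr rfl fun v _ => ?_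
  unfold cost
  split_ifs <;> ring

variable {part a b} {r : Sym2 V → ℝ}

/-- The energy counts each unordered pair twice and the diagonal once, at cost `a` per vertex; hence
the correction `a * S.card` and the factor `1 / 2`. -/
theorem prod_pairs_eq_exp (hr : ∀ u v, r s(u, v) = Real.exp (-cost part a b u v)) (S : Finset V) :
    ∏ e ∈ pairs S, r e = Real.exp (-(energy part a b S - a * S.card) / 2) := by
  have hpos : ∀ e, 0 < r e := fun e => by
    induction e with | _ u v => rw [hr]; exact Real.exp_pos _
  have h := sum_sum_eq_two_mul_sum_pairs S fun e => -Real.log (r e)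
  simp only [hr, Real.log_exp, neg_neg] at h
  rw [← Real.exp_log (Finset.prod_pos fun e _ => hpos e), Real.log_prod fun e _ => (hpos e).ne']
  congr 1
  have h' : energy part a b S = 2 * ∑ e ∈ pairs S, -Real.log (r e) + S.card * a := by
    rw [energy, h]
    simp [cost]
  rw [Finset.sum_neg_distrib] at h'
  linarith

/-- With high probability, no set that is independent has a large energy. -/
theorem pr_exists_high_energy_le [Fintype V] (ha : 0 ≤ a) (hb : 0 ≤ b)
    (hr : ∀ u v, r s(u, v) = Real.exp (-cost part a b u v)) (L δ : ℝ) :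
    pr r (fun R => ∃ S : Finset V, pairs S ⊆ R ∧
      L * S.card + δ < energy part a b S / 2) ≤
      Real.exp (-δ) * Real.exp (Fintype.card V * Real.exp (a / 2 - L)) := by
  have hcost : ∀ u v, 0 ≤ cost part a b u v := fun u v => by unfold cost; split_ifs <;> assumption
  have h0 : ∀ e, 0 ≤ r e := fun e => by
    induction e with | _ u v => rw [hr]; exact (Real.exp_pos _).le
  have h1 : ∀ e, r e ≤ 1 := fun e => by
    induction e with
    | _ u v => rw [hr]; exact Real.exp_le_one_iff.2 (neg_nonpos.2 (hcost u v))
  set x := Real.exp (a / 2 - L)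
  have hx : 0 ≤ x := (Real.exp_pos _).le
  let bad : Finset (Finset V) := Finset.univ.filter fun S => L * S.card + δ < energy part a b S / 2
  calc pr r (fun R => ∃ S : Finset V, pairs S ⊆ R ∧ L * S.card + δ < energy part a b S / 2)
      ≤ ∑ S ∈ bad, pr r (fun R => pairs S ⊆ R) :=
        pr_le_sum h0 h1 _ fun R ⟨S, hS, hbad⟩ => ⟨S, by simpa [bad] using hbad, hS⟩
    _ ≤ ∑ S ∈ bad, Real.exp (-δ) * x ^ S.card := by
        refine Finset.sum_le_sum fun S hS => ?_
        have hS' : L * S.card + δ < energy part a b S / 2 := by simpa [bad] using hS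
        rw [pr_subset, prod_pairs_eq_exp hr, ← Real.exp_nat_mul, ← Real.exp_add]
        exact Real.exp_le_exp.2 (by nlinarith)
    -- Once the energy condition has been used, summing over all sets lets the binomial theorem
    -- treat all sizes together.
    _ ≤ ∑ S : Finset V, Real.exp (-δ) * x ^ S.card :=
        Finset.sum_le_sum_of_subset_of_nonneg (Finset.subset_univ _) fun S _ _ => by positivity
    _ = Real.exp (-δ) * (x + 1) ^ Fintype.card V := by
        rw [← Finset.mul_sum, ← Fintype.sum_pow_mul_eq_add_pow V x 1]
        simp
    _ ≤ Real.exp (-δ) * Real.exp (Fintype.card V * x) := by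
        rw [Real.exp_nat_mul]
        gcongr
        exact Real.add_one_le_exp x

/-- The lower bound on the number of colours when all independent sets have low energy. -/
theorem sq_card_le_of_coloring [Fintype V] (hb : 0 ≤ b) (hab : b ≤ a) (hk : 0 < k)
    {G : SimpleGraph V} {m : ℕ} (hG : G.Colorable m) (L δ : ℝ)
    (hS : ∀ S : Finset V, G.IsIndepSet S → energy part a b S / 2 ≤ L * S.card + δ) :
    (Fintype.card V : ℝ) ^ 2 * ((a + (k - 1) * b) / k) ≤
      2 * m * (L * Fintype.card V + m * δ) := by
  obtain ⟨col⟩ := hG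
  let C : Fin m → Finset V := fun c => Finset.univ.filter fun v => col v = c
  have hC : ∀ c, G.IsIndepSet (C c) := by
    intro c u hu v hv _ hadj
    simp only [C, Finset.coe_filter, Finset.mem_univ, true_and, Set.mem_ofPred_eq] at hu hv
    exact col.valid hadj (hu.trans hv.symm)
  have hcard : ∑ c, ((C c).card : ℝ) = Fintype.card V := by
    have := Finset.card_eq_sum_card_fiberwise (s := (Finset.univ : Finset V)) (t := Finset.univ)
      (f := fun v => col v) (fun v _ => Finset.mem_univ _)
    rw [← Finset.card_univ, this]
    push_cast
    rfl
  have hcard2 : ∑ c, ∑ i, (((C c).filter fun v => part v = i).card : ℝ) = Fintype.card V := by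
    rw [← hcard]
    refine Finset.sum_congr rfl fun c _ => ?_
    have := Finset.card_eq_sum_card_fiberwise (s := C c) (t := Finset.univ)
      (f := part) (fun v _ => Finset.mem_univ _)
    rw [this]
    push_cast
    rfl
  -- Cauchy–Schwarz over the `m` classes here, and over the `m * k` intersections of classes with
  -- parts in `hsq2`.
  have hsq1 : (Fintype.card V : ℝ) ^ 2 ≤ m * ∑ c, ((C c).card : ℝ) ^ 2 := by
    rw [← hcard]
    simpa using sq_sum_le_card_mul_sum_sq (s := (Finset.univ : Finset (Fin m)))
      (f := fun c => ((C c).card : ℝ))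
  have hsq2 : (Fintype.card V : ℝ) ^ 2 ≤
      m * k * ∑ c, ∑ i, (((C c).filter fun v => part v = i).card : ℝ) ^ 2 := by
    rw [← hcard2, ← Fintype.sum_prod_type', ← Fintype.sum_prod_type']
    simpa using sq_sum_le_card_mul_sum_sq (s := (Finset.univ : Finset (Fin m × Fin k)))
      (f := fun x => (((C x.1).filter fun v => part v = x.2).card : ℝ))
  have hsum : ∑ c, energy part a b (C c) ≤ 2 * (L * Fintype.card V + m * δ) := by
    calc ∑ c, energy part a b (C c) ≤ ∑ c, 2 * (L * (C c).card + δ) :=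
          Finset.sum_le_sum fun c _ => by linarith [hS _ (hC c)]
      _ = _ := by
          rw [← Finset.mul_sum, Finset.sum_add_distrib, ← Finset.mul_sum, hcard]
          simp
  simp only [energy_eq, Finset.sum_add_distrib, ← Finset.mul_sum] at hsum
  have hk' : (0 : ℝ) < k := by exact_mod_cast hk
  set X := ∑ c, ∑ i, (((C c).filter fun v => part v = i).card : ℝ) ^ 2
  set Y := ∑ c, ((C c).card : ℝ) ^ 2
  set N := (Fintype.card V : ℝ)
  have e : N ^ 2 * ((a + (k - 1) * b) / k) = (a - b) * (N ^ 2 / k) + b * N ^ 2 := by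
    field_simp; ring
  have hX : N ^ 2 / k ≤ m * X := by rw [div_le_iff₀ hk']; linarith
  calc N ^ 2 * ((a + (k - 1) * b) / k) = (a - b) * (N ^ 2 / k) + b * N ^ 2 := e
    _ ≤ (a - b) * (m * X) + b * (m * Y) :=
        add_le_add (mul_le_mul_of_nonneg_left hX (sub_nonneg.2 hab))
          (mul_le_mul_of_nonneg_left hsq1 hb)
    _ = m * ((a - b) * X + b * Y) := by ring
    _ ≤ m * (2 * (L * N + m * δ)) := mul_le_mul_of_nonneg_left hsum (by positivity)
    _ = _ := by ring

theorem pairs_subset_of_isIndepSet {S : Finset V} {R : Finset (Sym2 V)}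
    (h : (graphOfNonedges R).IsIndepSet S) : pairs S ⊆ R := by
  intro e he
  induction e with
  | _ u v =>
    obtain ⟨hu, hv, hne⟩ := mk_mem_pairs.1 he
    by_contra hR
    exact h hu hv hne (by simpa [graphOfNonedges, hR] using hne)

theorem isIndepSet_of_pairs_subset {S : Finset V} {R : Finset (Sym2 V)} (h : pairs S ⊆ R) :
    (graphOfNonedges R).IsIndepSet S := by
  intro u hu v hv hne hadj
  have : s(u, v) ∉ R := by simpa [graphOfNonedges, hne] using hadj
  exact this (h (mk_mem_pairs.2 ⟨hu, hv, hne⟩))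

end Pairs

/-! ### Independent transversals in every large vertex set. -/

section Transversal

variable {V : Type*} {k ℓ w : ℕ} {part : V → Fin k} {a b : ℝ} {r : Sym2 V → ℝ}

/-- The set that consists of the `x j`-th element of the `j`-th cell of `φ`, for all `j ∈ D`. -/
def transversal (φ : (Fin k × Fin ℓ) × Fin w → V) (x : Fin k × Fin ℓ → Fin w)
    (D : Finset (Fin k × Fin ℓ)) : Finset V :=
  D.image fun j => φ (j, x j)

/-- The cells on which `x` and `y` agree. -/
def agree (x y : Fin k × Fin ℓ → Fin w) : Finset (Fin k × Fin ℓ) :=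
  Finset.univ.filter fun j => x j = y j

variable {φ : (Fin k × Fin ℓ) × Fin w → V} (hφ : Function.Injective φ)

include hφ in
theorem card_transversal (x : Fin k × Fin ℓ → Fin w) (D : Finset (Fin k × Fin ℓ)) :
    (transversal φ x D).card = D.card :=
  Finset.card_image_of_injective _ fun _ _ h => congrArg Prod.fst (hφ h)

include hφ in
theorem transversal_inter (x y : Fin k × Fin ℓ → Fin w) :
    transversal φ x Finset.univ ∩ transversal φ y Finset.univ = transversal φ x (agree x y) := by
  ext v
  simp only [transversal, Finset.mem_inter, Finset.mem_image, Finset.mem_univ, true_and, agree,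
    Finset.mem_filter]
  constructor
  · rintro ⟨⟨j, rfl⟩, j', h⟩
    have h' := hφ h
    obtain rfl : j' = j := congrArg Prod.fst h'
    exact ⟨j', (congrArg Prod.snd h').symm, rfl⟩
  · rintro ⟨j, hj, rfl⟩
    exact ⟨⟨j, rfl⟩, j, by rw [hj]⟩

theorem pairs_inter (S T : Finset V) : pairs S ∩ pairs T = pairs (S ∩ T) := by
  ext e
  induction e with
  | _ u v => simp only [Finset.mem_inter, mk_mem_pairs]; tauto

theorem card_transversal_part (hφ : Function.Injective φ) (hpart : ∀ j, part (φ j) = j.1.1)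
    (x : Fin k × Fin ℓ → Fin w) (i : Fin k) :
    ((transversal φ x Finset.univ).filter fun v => part v = i).card = ℓ := by
  have : (transversal φ x Finset.univ).filter (fun v => part v = i) =
      transversal φ x (Finset.univ.image fun t => (i, t)) := by
    ext v
    simp only [transversal, Finset.mem_filter, Finset.mem_image, Finset.mem_univ, true_and]
    constructor
    · rintro ⟨⟨⟨i', t⟩, rfl⟩, h⟩
      rw [hpart] at h
      subst h
      exact ⟨_, ⟨t, rfl⟩, rfl⟩
    · rintro ⟨_, ⟨t, rfl⟩, rfl⟩
      exact ⟨⟨_, rfl⟩, hpart _⟩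
  rw [this, card_transversal hφ, Finset.card_image_of_injective _ (Prod.mk_right_injective i)]
  simp

theorem energy_transversal (hφ : Function.Injective φ) (hpart : ∀ j, part (φ j) = j.1.1)
    (x : Fin k × Fin ℓ → Fin w) (D : Finset (Fin k × Fin ℓ)) :
    energy part a b (transversal φ x D) =
      ∑ j ∈ D, ∑ j' ∈ D, if j.1 = j'.1 then a else b := by
  have hinj : Set.InjOn (fun j => φ (j, x j)) (D : Set (Fin k × Fin ℓ)) :=
    fun _ _ _ _ h => congrArg Prod.fst (hφ h)
  simp only [energy, transversal, Finset.sum_image hinj, cost, hpart]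

/-- Both entries of the minimum bound a row sum: every cost is at most `a`, and a full row of the
balanced `k × ℓ` array sums to `ℓ * (a + (k - 1) * b)`. The first serves small `D`; the second
serves large `D`, however unbalanced. -/
theorem energy_transversal_le (ha : 0 ≤ a) (hb : 0 ≤ b) (hab : b ≤ a)
    (hφ : Function.Injective φ) (hpart : ∀ j, part (φ j) = j.1.1)
    (x : Fin k × Fin ℓ → Fin w) (D : Finset (Fin k × Fin ℓ)) :
    energy part a b (transversal φ x D) ≤
      D.card * min (a * D.card) (ℓ * (a + (k - 1) * b)) := by
  rw [energy_transversal hφ hpart, ← nsmul_eq_mul]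
  refine Finset.sum_le_card_nsmul _ _ _ fun j _ => le_min ?_ ?_
  · calc ∑ j' ∈ D, (if j.1 = j'.1 then a else b) ≤ ∑ j' ∈ D, a :=
          Finset.sum_le_sum fun j' _ => by split_ifs <;> linarith
      _ = a * D.card := by simp [mul_comm]
  · calc ∑ j' ∈ D, (if j.1 = j'.1 then a else b) ≤
          ∑ j' : Fin k × Fin ℓ, (if j.1 = j'.1 then a else b) := by
          refine Finset.sum_le_sum_of_subset_of_nonneg (Finset.subset_univ _) fun j' _ _ => ?_
          split_ifs <;> assumption
      _ = ∑ i : Fin k, ∑ _t : Fin ℓ, (if j.1 = i then a else b) :=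
          Fintype.sum_prod_type' (fun i (_ : Fin ℓ) => if j.1 = i then a else b)
      _ = ∑ i : Fin k, ((ℓ : ℝ) * b + if j.1 = i then ℓ * (a - b) else 0) := by
          refine Finset.sum_congr rfl fun i _ => ?_
          split_ifs <;> (simp; try ring)
      _ = ℓ * (a + (k - 1) * b) := by
          rw [Finset.sum_add_distrib]
          simp
          ring

theorem card_agree_superset (x : Fin k × Fin ℓ → Fin w) (D : Finset (Fin k × Fin ℓ)) (hw : 0 < w) :
    ((Finset.univ.filter fun y => D ⊆ agree x y).card : ℝ) =
      (w : ℝ) ^ (k * ℓ) * (1 / w) ^ D.card := by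
  have : (Finset.univ.filter fun y => D ⊆ agree x y) =
      Fintype.piFinset fun j => if j ∈ D then {x j} else Finset.univ := by
    ext y
    simp only [agree, Finset.subset_iff, Finset.mem_filter, Finset.mem_univ, true_and,
      Fintype.mem_piFinset]
    refine forall_congr' fun j => ?_
    split_ifs with h <;> simp [h, eq_comm]
  have hle : D.card ≤ k * ℓ := by simpa using Finset.card_le_univ D
  have hc : (Finset.univ.filter fun j => j ∉ D).card = k * ℓ - D.card := by
    have h1 : (Finset.univ.filter fun j => j ∉ D) = Dᶜ := by ext; simp
    rw [h1, Finset.card_compl]; simp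
  rw [this, Fintype.card_piFinset]
  have h2 : ∀ j, (if j ∈ D then ({x j} : Finset (Fin w)) else Finset.univ).card =
      if j ∈ D then 1 else w := fun j => by split_ifs <;> simp
  simp only [h2, Finset.prod_ite, Finset.prod_const, one_pow, one_mul, hc]
  have hw' : (w : ℝ) ≠ 0 := by exact_mod_cast hw.ne'
  push_cast
  rw [one_div, inv_pow, ← div_eq_mul_inv, pow_sub₀ _ hw' hle, div_eq_mul_inv]

/-- The bound on the ratio `Δ / μ ^ 2` in Janson's inequality. -/
def secondMoment (k ℓ w : ℕ) (a b : ℝ) : ℝ :=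
  ∑ D : Finset (Fin k × Fin ℓ), if 2 ≤ D.card then
    (1 / (w : ℝ)) ^ D.card * Real.exp (D.card * min (a * D.card) (ℓ * (a + (k - 1) * b)) / 2)
    else 0

variable [Fintype V]

/-- The probability that there is no independent transversal. -/
theorem pr_no_transversal_le (ha : 0 ≤ a) (hb : 0 ≤ b) (hab : b ≤ a)
    (hr : ∀ u v, r s(u, v) = Real.exp (-cost part a b u v))
    (hφ : Function.Injective φ) (hpart : ∀ j, part (φ j) = j.1.1) (hw : 0 < w) (hkℓ : 2 ≤ k * ℓ) :
    pr r (fun R => ∀ x, ¬ pairs (transversal φ x Finset.univ) ⊆ R) ≤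
      Real.exp (-1 / (2 * secondMoment k ℓ w a b)) := by
  have hcost : ∀ u v, 0 ≤ cost part a b u v := fun u v => by unfold cost; split_ifs <;> assumption
  have hpos : ∀ e, 0 < r e := fun e => by
    induction e with | _ u v => rw [hr]; exact Real.exp_pos _
  have h0 : ∀ e, 0 ≤ r e := fun e => (hpos e).le
  have h1 : ∀ e, r e ≤ 1 := fun e => by
    induction e with
    | _ u v => rw [hr]; exact Real.exp_le_one_iff.2 (neg_nonpos.2 (hcost u v))
  let A : (Fin k × Fin ℓ → Fin w) → Finset (Sym2 V) := fun x => pairs (transversal φ x Finset.univ)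
  -- All transversals have the same part sizes, hence the same probability `π` of being independent.
  obtain ⟨π, hπ0, hπ⟩ : ∃ π : ℝ, 0 < π ∧ ∀ x, ∏ e ∈ A x, r e = π := by
    refine ⟨Real.exp (-((∑ j : Fin k × Fin ℓ, ∑ j' : Fin k × Fin ℓ, if j.1 = j'.1 then a else b) -
      a * (Finset.univ : Finset (Fin k × Fin ℓ)).card) / 2), Real.exp_pos _, fun x => ?_⟩
    rw [prod_pairs_eq_exp hr, energy_transversal hφ hpart, card_transversal hφ]
  let h : ℕ → ℝ := fun s => s * min (a * s) (ℓ * (a + (k - 1) * b)) / 2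
  -- The probability that both transversals are independent is `π ^ 2` divided by that of their
  -- common part, whose energy is bounded by `energy_transversal_le`; the diagonal correction can be
  -- dropped.
  have hunion : ∀ x y, ∏ e ∈ A x ∪ A y, r e ≤ π ^ 2 * Real.exp (h (agree x y).card) := by
    intro x y
    have hui := Finset.prod_union_inter (s₁ := A x) (s₂ := A y) (f := r)
    have hinter : ∏ e ∈ A x ∩ A y, r e =
        Real.exp (-(energy part a b (transversal φ x (agree x y)) - a * (agree x y).card) / 2) := by
      rw [pairs_inter, transversal_inter hφ, prod_pairs_eq_exp hr, card_transversal hφ]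
    rw [hπ, hπ, hinter] at hui
    rw [← mul_le_mul_iff_left₀ (Real.exp_pos
      (-(energy part a b (transversal φ x (agree x y)) - a * (agree x y).card) / 2)), hui, mul_assoc,
      ← Real.exp_add, sq]
    refine le_mul_of_one_le_right (by positivity) (Real.one_le_exp ?_)
    have := energy_transversal_le ha hb hab hφ hpart x (agree x y)
    have : 0 ≤ a * (agree x y).card := by positivity
    simp only [h]
    linarith
  -- `F` dominates `corr` and keeps the diagonal `x = y`. Its double sum therefore bounds both `Δ`
  -- and `μ`, as the extended inequality requires of `D`.
  let F : (Fin k × Fin ℓ → Fin w) → (Fin k × Fin ℓ → Fin w) → ℝ := fun x y =>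
    if 2 ≤ (agree x y).card then ∏ e ∈ A x ∪ A y, r e else 0
  have hF0 : ∀ x y, 0 ≤ F x y := fun x y => by
    simp only [F]; split_ifs; exacts [Finset.prod_nonneg fun e _ => h0 e, le_rfl]
  have hcorr : ∀ x y, corr A r x y ≤ F x y := by
    intro x y
    unfold corr
    split_ifs with hc
    · suffices h2 : 2 ≤ (agree x y).card by
        simp only [F, h2, if_true]
        exact le_of_eq (by congr!)
      obtain ⟨-, hc⟩ := hc
      rw [Finset.not_disjoint_iff_nonempty_inter, pairs_inter, transversal_inter hφ] at hc
      obtain ⟨e, he⟩ := hc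
      rw [← card_transversal hφ x]
      induction e with
      | _ u v =>
        obtain ⟨hu, hv, hne⟩ := mk_mem_pairs.1 he
        exact Finset.one_lt_card.2 ⟨u, hu, v, hv, hne⟩
    · exact hF0 x y
  have hdiag : ∀ x, F x x = π := by
    intro x
    have : (agree x x).card = k * ℓ := by simp [agree]
    simp only [F, this, hkℓ, if_true, Finset.union_self, hπ]
  set N : ℝ := (w : ℝ) ^ (k * ℓ)
  have hN : 0 < N := by positivity
  have hcardx : ((Finset.univ : Finset (Fin k × Fin ℓ → Fin w)).card : ℝ) = N := by
    simp [N]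
  have hμ : ∑ x, ∏ e ∈ A x, r e = N * π := by
    simp only [hπ, Finset.sum_const, nsmul_eq_mul, hcardx]
  have hrow : ∀ x, ∑ y, F x y ≤ π ^ 2 * N * secondMoment k ℓ w a b := by
    intro x
    -- The term of `D = agree x y` is enlarged to all `D ⊆ agree x y`, since the number of `y`
    -- agreeing with `x` on `D` at least has a product form.
    calc ∑ y, F x y ≤ ∑ y, ∑ D : Finset (Fin k × Fin ℓ), (if 2 ≤ D.card then
          (if D ⊆ agree x y then π ^ 2 * Real.exp (h D.card) else 0) else 0) := by
          refine Finset.sum_le_sum fun y _ => ?_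
          have hnn : ∀ D ∈ (Finset.univ : Finset (Finset (Fin k × Fin ℓ))),
              0 ≤ if 2 ≤ D.card then
                (if D ⊆ agree x y then π ^ 2 * Real.exp (h D.card) else 0) else 0 := by
            intro D _
            split_ifs <;> positivity
          refine le_trans ?_ (Finset.single_le_sum hnn (Finset.mem_univ (agree x y)))
          simp only [F, Finset.Subset.refl, if_true]
          split_ifs
          exacts [hunion x y, le_rfl]
      _ = ∑ D : Finset (Fin k × Fin ℓ), (if 2 ≤ D.card then
            (N * (1 / w) ^ D.card) * (π ^ 2 * Real.exp (h D.card)) else 0) := by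
          rw [Finset.sum_comm]
          refine Finset.sum_congr rfl fun D _ => ?_
          split_ifs
          · rw [← card_agree_superset x D hw, ← Finset.sum_filter, Finset.sum_const, nsmul_eq_mul]
          · simp
      _ = π ^ 2 * N * secondMoment k ℓ w a b := by
          rw [secondMoment, Finset.mul_sum]
          refine Finset.sum_congr rfl fun D _ => ?_
          split_ifs
          · simp only [h]; ring
          · simp
  have hFsum : ∑ x, ∑ y, F x y ≤ (N * π) ^ 2 * secondMoment k ℓ w a b := by
    calc ∑ x, ∑ y, F x y ≤ ∑ x : Fin k × Fin ℓ → Fin w, π ^ 2 * N * secondMoment k ℓ w a b :=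
          Finset.sum_le_sum fun x _ => hrow x
      _ = _ := by rw [Finset.sum_const, nsmul_eq_mul, hcardx]; ring
  have hμle : N * π ≤ (N * π) ^ 2 * secondMoment k ℓ w a b := by
    refine le_trans ?_ hFsum
    calc N * π = ∑ x, F x x := by simp only [hdiag, Finset.sum_const, nsmul_eq_mul, hcardx]
      _ ≤ ∑ x, ∑ y, F x y := Finset.sum_le_sum fun x _ =>
          Finset.single_le_sum (f := F x) (fun y _ => hF0 x y) (Finset.mem_univ x)
  have hD0 : 0 < (N * π) ^ 2 * secondMoment k ℓ w a b := lt_of_lt_of_le (by positivity) hμle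
  have hΔ : ∑ x, ∑ y, corr A r x y ≤ (N * π) ^ 2 * secondMoment k ℓ w a b :=
    (Finset.sum_le_sum fun x _ => Finset.sum_le_sum fun y _ => hcorr x y).trans hFsum
  have := pr_avoid_le_exp_sq_div A h0 h1 hD0 (by rw [hμ]; exact hμle) hΔ
  refine this.trans (le_of_eq ?_)
  rw [hμ]
  congr 1
  have : 0 < secondMoment k ℓ w a b := pos_of_mul_pos_right hD0 (by positivity)
  field_simp

omit [Fintype V] in
theorem exists_cells {U : Finset V} (hU : ∀ i, w * ℓ ≤ (U.filter fun v => part v = i).card) :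
    ∃ φ : (Fin k × Fin ℓ) × Fin w → V, Function.Injective φ ∧ (∀ j, part (φ j) = j.1.1) ∧
      ∀ j, φ j ∈ U := by
  have : ∀ i, ∃ f : Fin ℓ × Fin w → V, Function.Injective f ∧
      ∀ t, f t ∈ U.filter fun v => part v = i := by
    intro i
    have hc : Fintype.card (Fin ℓ × Fin w) ≤ Fintype.card (U.filter fun v => part v = i) := by
      rw [Fintype.card_coe]
      simpa [mul_comm] using hU i
    obtain ⟨f⟩ := Function.Embedding.nonempty_of_card_le hc
    exact ⟨fun t => f t, Subtype.val_injective.comp f.injective, fun t => (f t).2⟩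
  choose f hf hfU using this
  have hpart : ∀ i t, part (f i t) = i := fun i t => (Finset.mem_filter.1 (hfU i t)).2
  refine ⟨fun j => f j.1.1 (j.1.2, j.2), ?_, fun j => hpart _ _,
    fun j => (Finset.mem_filter.1 (hfU _ _)).1⟩
  rintro ⟨⟨i, t⟩, s⟩ ⟨⟨i', t'⟩, s'⟩ h
  obtain rfl : i = i' := by rw [← hpart i (t, s), ← hpart i' (t', s')]; exact congrArg part h
  have := hf i h
  simp_all

/-- With high probability, every large set of vertices contains a large independent set. -/
theorem pr_exists_no_indep_le (ha : 0 ≤ a) (hb : 0 ≤ b) (hab : b ≤ a)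
    (hr : ∀ u v, r s(u, v) = Real.exp (-cost part a b u v)) (hw : 0 < w) (hkℓ : 2 ≤ k * ℓ) :
    pr r (fun R => ¬ ∀ U : Finset V, (∀ i, w * ℓ ≤ (U.filter fun v => part v = i).card) →
      ∃ S ⊆ U, pairs S ⊆ R ∧ ∀ i, (S.filter fun v => part v = i).card = ℓ) ≤
      2 ^ Fintype.card V * Real.exp (-1 / (2 * secondMoment k ℓ w a b)) := by
  have hpos : ∀ e, 0 ≤ r e := fun e => by
    induction e with | _ u v => rw [hr]; exact (Real.exp_pos _).le
  have h1 : ∀ e, r e ≤ 1 := fun e => by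
    induction e with
    | _ u v =>
      rw [hr]
      refine Real.exp_le_one_iff.2 (neg_nonpos.2 ?_)
      unfold cost
      split_ifs <;> assumption
  let T : Finset (Finset V) :=
    Finset.univ.filter fun U => ∀ i, w * ℓ ≤ (U.filter fun v => part v = i).card
  refine (pr_le_sum hpos h1 T (Q := fun U R => ∀ S ⊆ U, pairs S ⊆ R →
    ¬ ∀ i, (S.filter fun v => part v = i).card = ℓ) fun R hR => ?_).trans ?_
  · push Not at hR
    obtain ⟨U, hU, hS⟩ := hR
    exact ⟨U, by simpa [T] using hU, fun S hSU hSR hSi => by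
      obtain ⟨i, hi⟩ := hS S hSU hSR
      exact hi (hSi i)⟩
  · calc _ ≤ ∑ U ∈ T, Real.exp (-1 / (2 * secondMoment k ℓ w a b)) := by
          refine Finset.sum_le_sum fun U hU => ?_
          obtain ⟨φ, hφ, hpart, hφU⟩ := exists_cells (Finset.mem_filter.1 hU).2
          refine (pr_mono hpos h1 fun R hR x hx => ?_).trans
            (pr_no_transversal_le ha hb hab hr hφ hpart hw hkℓ)
          refine hR _ ?_ hx (card_transversal_part hφ hpart x)
          intro v hv
          obtain ⟨j, -, rfl⟩ := Finset.mem_image.1 hv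
          exact hφU _
      _ ≤ 2 ^ Fintype.card V * Real.exp (-1 / (2 * secondMoment k ℓ w a b)) := by
          rw [Finset.sum_const, nsmul_eq_mul]
          gcongr
          have : T.card ≤ 2 ^ Fintype.card V := by
            simpa using Finset.card_le_univ T
          exact_mod_cast this

end Transversal

/-! ### Colouring by greedy removal of independent sets. -/

section Greedy

variable {V : Type*} {k ℓ u : ℕ} {part : V → Fin k}

/-- Repeatedly removing independent sets with `ℓ` vertices in each part gives a colouring. -/
theorem exists_greedy_coloring {G : SimpleGraph V}
    (H : ∀ U : Finset V, (∀ i, u ≤ (U.filter fun v => part v = i).card) →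
      ∃ S ⊆ U, G.IsIndepSet S ∧ ∀ i, (S.filter fun v => part v = i).card = ℓ) (s : ℕ) :
    ∀ U : Finset V, (∀ i, u + s * ℓ ≤ (U.filter fun v => part v = i).card) →
      ∃ m, m + s * (k * ℓ) = s + U.card ∧ ∃ f : V → ℕ, (∀ v ∈ U, f v < m) ∧
        ∀ v ∈ U, ∀ v' ∈ U, G.Adj v v' → f v ≠ f v' := by
  induction s with
  | zero =>
    intro U _
    -- After the last round each remaining vertex receives a colour of its own.
    refine ⟨U.card, by simp, fun v => if h : v ∈ U then U.equivFin ⟨v, h⟩ else 0,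
      fun v hv => by simp [hv], fun v hv v' hv' hadj h => ?_⟩
    simp only [hv, hv', dif_pos] at h
    have := U.equivFin.injective (Fin.ext h)
    exact hadj.ne (congrArg Subtype.val this)
  | succ s ih =>
    intro U hU
    obtain ⟨S, hSU, hS, hSi⟩ := H U fun i => (Nat.le_add_right _ _).trans (hU i)
    have hcard : S.card = k * ℓ := by
      rw [Finset.card_eq_sum_card_fiberwise (t := Finset.univ) (f := part)
        fun v _ => Finset.mem_univ _]
      simp [hSi]
    have hU' : ∀ i, u + s * ℓ ≤ ((U \ S).filter fun v => part v = i).card := by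
      intro i
      have h1 : (U \ S).filter (fun v => part v = i) =
          (U.filter fun v => part v = i) \ (S.filter fun v => part v = i) := by
        ext v; simp only [Finset.mem_filter, Finset.mem_sdiff]; tauto
      rw [h1, Finset.card_sdiff_of_subset (Finset.filter_subset_filter _ hSU), hSi]
      have := hU i
      rw [add_mul] at this
      omega
    obtain ⟨m, hm, f, hf, hfadj⟩ := ih (U \ S) hU'
    have hle := Finset.card_le_card hSU
    rw [Finset.card_sdiff_of_subset hSU, hcard] at hm
    rw [hcard] at hle
    refine ⟨m + 1, by rw [add_mul]; omega, fun v => if v ∈ S then m else f v, fun v hv => ?_,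
      fun v hv v' hv' hadj => ?_⟩
    · beta_reduce
      split_ifs with h
      · omega
      · exact (hf v (Finset.mem_sdiff.2 ⟨hv, h⟩)).trans (Nat.lt_succ_self m)
    · have hlt : ∀ x ∈ U, x ∉ S → f x < m := fun x hx h => hf x (Finset.mem_sdiff.2 ⟨hx, h⟩)
      by_cases h : v ∈ S <;> by_cases h' : v' ∈ S
      · exact absurd hadj (hS h h' hadj.ne)
      · simpa [h, h'] using (hlt v' hv' h').ne'
      · simpa [h, h'] using (hlt v hv h).ne
      · simpa [h, h'] using
          hfadj v (Finset.mem_sdiff.2 ⟨hv, h⟩) v' (Finset.mem_sdiff.2 ⟨hv', h'⟩) hadj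

/-- The upper bound on the chromatic number if every large set contains an independent set with
`ℓ` vertices in each part. -/
theorem chromaticNumber_le_of_indep [Fintype V] {G : SimpleGraph V} (hk : 0 < k) (hℓ : 0 < ℓ)
    (H : ∀ U : Finset V, (∀ i, u ≤ (U.filter fun v => part v = i).card) →
      ∃ S ⊆ U, G.IsIndepSet S ∧ ∀ i, (S.filter fun v => part v = i).card = ℓ)
    (hpart : ∀ i, (Fintype.card V : ℝ) / k - 1 ≤ (Finset.univ.filter fun v => part v = i).card) :
    (G.chromaticNumber.toNat : ℝ) ≤ Fintype.card V / (k * ℓ) + k * (1 + u + ℓ) := by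
  have hk' : (0 : ℝ) < k := by exact_mod_cast hk
  have hℓ' : (0 : ℝ) < ℓ := by exact_mod_cast hℓ
  set n := Fintype.card V
  have hchi : ∀ m, G.Colorable m → (G.chromaticNumber.toNat : ℝ) ≤ m := fun m hm => by
    have := hm.chromaticNumber_le
    exact_mod_cast ENat.toNat_le_of_le_natCast this
  -- If the parts may be too small for a single round, `n ≤ k * (1 + u)` and one colour per vertex
  -- suffices.
  rcases lt_or_ge ((n : ℝ) / k - 1 - u) 0 with hneg | hpos
  · have h1 : (n : ℝ) ≤ k * (1 + u) := by
      have : (n : ℝ) / k ≤ 1 + u := by linarith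
      rwa [div_le_iff₀' hk'] at this
    have h2 : (0 : ℝ) ≤ n / (k * ℓ) := by positivity
    have h3 : (0 : ℝ) ≤ k * ℓ := by positivity
    have := hchi n (G.colorable_of_fintype)
    linarith
  set s := ⌊((n : ℝ) / k - 1 - u) / ℓ⌋₊
  have hs1 : (s : ℝ) * ℓ ≤ (n : ℝ) / k - 1 - u := by
    rw [← le_div_iff₀ hℓ']; exact Nat.floor_le (by positivity)
  have hs2 : (n : ℝ) / k - 1 - u ≤ (s + 1 : ℝ) * ℓ := by
    rw [← div_le_iff₀ hℓ']; exact (Nat.lt_floor_add_one _).le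
  obtain ⟨m, hm, f, hf, hfadj⟩ := exists_greedy_coloring H s Finset.univ fun i => by
    have := hpart i
    have h : (u : ℝ) + s * ℓ ≤ (Finset.univ.filter fun v => part v = i).card := by linarith
    exact_mod_cast h
  have hcol : G.Colorable m := ⟨SimpleGraph.Coloring.mk
    (fun v => (⟨f v, hf v (Finset.mem_univ v)⟩ : Fin m)) fun {v v'} hadj h =>
      hfadj v (Finset.mem_univ v) v' (Finset.mem_univ v') hadj (congrArg Fin.val h)⟩
  have hm' : (m : ℝ) + s * (k * ℓ) = s + n := by
    rw [Finset.card_univ] at hm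
    exact_mod_cast hm
  have h1 : (n : ℝ) ≤ k * (1 + u) + s * (k * ℓ) + k * ℓ := by
    have : (n : ℝ) / k ≤ 1 + u + (s + 1) * ℓ := by linarith
    rw [div_le_iff₀' hk'] at this
    linarith
  have h2 : (s : ℝ) ≤ n / (k * ℓ) := by
    rw [le_div_iff₀ (by positivity)]
    have : (s : ℝ) * ℓ ≤ n / k := by
      have : (0 : ℝ) ≤ u := by positivity
      linarith
    rw [le_div_iff₀ hk'] at this
    linarith
  have := hchi m hcol
  linarith

end Greedy

/-! ### Numerical estimates and translation to the block model. -/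

theorem secondMoment_le {k ℓ w : ℕ} {a b κ : ℝ}
    (h : ∀ s : ℕ, 2 ≤ s → s ≤ k * ℓ →
      ((k * ℓ : ℝ) / w) ^ s * Real.exp (s * min (a * s) (ℓ * (a + (k - 1) * b)) / 2) ≤ κ)
    (hκ : 0 ≤ κ) : secondMoment k ℓ w a b ≤ (k * ℓ + 1) * κ := by
  let f : ℕ → ℝ := fun s => if 2 ≤ s then
    (1 / (w : ℝ)) ^ s * Real.exp (s * min (a * s) (ℓ * (a + (k - 1) * b)) / 2) else 0
  have h1 : secondMoment k ℓ w a b = ∑ s ∈ Finset.range (k * ℓ + 1), ((k * ℓ).choose s) • f s := by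
    have := Finset.sum_powerset_apply_card f (x := (Finset.univ : Finset (Fin k × Fin ℓ)))
    rw [Finset.powerset_univ] at this
    simpa [secondMoment, f] using this
  rw [h1]
  calc _ ≤ ∑ s ∈ Finset.range (k * ℓ + 1), κ := by
        refine Finset.sum_le_sum fun s hs => ?_
        simp only [f, nsmul_eq_mul]
        split_ifs with h2
        · refine le_trans ?_ (h s h2 (Nat.lt_succ_iff.1 (Finset.mem_range.1 hs)))
          -- The sets `D` of size `s` number at most `(k * ℓ) ^ s`, which is absorbed into the power
          -- of `1 / w`.
          rw [← mul_assoc]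
          gcongr
          rw [div_eq_mul_one_div (k * ℓ : ℝ), mul_pow]
          gcongr
          exact_mod_cast Nat.choose_le_pow _ _
        · simpa using hκ
    _ = _ := by simp

/-- With `L = log n` every term is at most `n ^ (-3/2)`; any exponent beyond `1` would suffice to
beat `2 ^ n` later. If `4 * a * s ≤ L`, the exponent is at most `-(13/16) * s * L`, and `s ≥ 2`
suffices. Otherwise it is at most `-s * η * L / 2`, and `12 * a / η ≤ L` gives `s * η ≥ 3`. -/
theorem secondMoment_le_of_params {k ℓ w : ℕ} {a b L η δ : ℝ} (ha : 0 < a) (hL : 0 ≤ L)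
    (hη : 0 < η) (hδ : δ ≤ η / 2) (hδ' : δ ≤ 1 / 16) (hLη : 12 * a / η ≤ L)
    (hM : ℓ * (a + (k - 1) * b) ≤ 2 * (1 - η) * L)
    (hw : (k * ℓ : ℝ) / w ≤ Real.exp (-(1 - δ) * L)) :
    secondMoment k ℓ w a b ≤ (k * ℓ + 1) * Real.exp (-(3 / 2) * L) := by
  refine secondMoment_le (fun s hs _ => ?_) (Real.exp_pos _).le
  have hs' : (2 : ℝ) ≤ s := by exact_mod_cast hs
  calc _ ≤ (Real.exp (-(1 - δ) * L)) ^ s *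
        Real.exp (s * min (a * s) (ℓ * (a + (k - 1) * b)) / 2) := by gcongr
    _ = Real.exp (s * (-(1 - δ) * L) + s * min (a * s) (ℓ * (a + (k - 1) * b)) / 2) := by
        rw [← Real.exp_nat_mul, ← Real.exp_add]
    _ ≤ _ := Real.exp_le_exp.2 ?_
  rcases le_total (4 * a * s) L with hcase | hcase
  · have h1 : min (a * s) (ℓ * (a + (k - 1) * b)) ≤ L / 4 := (min_le_left _ _).trans (by linarith)
    have h2 : (s : ℝ) * min (a * s) (ℓ * (a + (k - 1) * b)) ≤ s * (L / 4) := by gcongr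
    have h3 : (s : ℝ) * (δ * L) ≤ s * (1 / 16 * L) := by gcongr
    have h4 : 2 * L ≤ s * L := by gcongr
    linarith
  · have h1 : min (a * s) (ℓ * (a + (k - 1) * b)) ≤ 2 * (1 - η) * L := (min_le_right _ _).trans hM
    have h2 : (s : ℝ) * min (a * s) (ℓ * (a + (k - 1) * b)) ≤ s * (2 * (1 - η) * L) := by gcongr
    have h3 : (s : ℝ) * (δ * L) ≤ s * (η / 2 * L) := by gcongr
    have h4 : 3 ≤ s * η := by
      rw [div_le_iff₀ hη] at hLη
      nlinarith
    have h5 : 3 * L ≤ s * η * L := by gcongr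
    linarith

/-- Rounding down costs at most one vertex, and the last part only gains from the rounding of the
others. -/
theorem div_sub_one_le_partSize {k : ℕ} (hk : 1 ≤ k) (n : ℕ) (i : Fin k) :
    (n : ℝ) / k - 1 ≤ partSize (balanced k) n i := by
  have hk' : (0 : ℝ) < k := by exact_mod_cast hk
  unfold partSize balanced
  have hfl : ((⌊1 / (k : ℝ) * n⌋₊ : ℕ) : ℝ) ≤ n / k := by
    rw [one_div_mul_eq_div]; exact Nat.floor_le (by positivity)
  split_ifs with h
  · set s := ∑ j ∈ Finset.univ.erase i, ⌊1 / (k : ℝ) * n⌋₊ with hs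
    have h1 : (s : ℝ) ≤ (k - 1) * (n / k) := by
      rw [hs, Finset.sum_const, Finset.card_erase_of_mem (Finset.mem_univ i), Finset.card_univ,
        Fintype.card_fin, smul_eq_mul, Nat.cast_mul, Nat.cast_sub hk, Nat.cast_one]
      exact mul_le_mul_of_nonneg_left hfl (sub_nonneg.2 (by exact_mod_cast hk))
    have h2 : (n : ℝ) ≤ (n - s : ℕ) + s := by exact_mod_cast (by omega : n ≤ n - s + s)
    have h3 : (k - 1 : ℝ) * (n / k) = n - n / k := by field_simp
    linarith
  · have := Nat.lt_floor_add_one (1 / (k : ℝ) * n)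
    rw [one_div_mul_eq_div] at this ⊢
    linarith

theorem card_filter_part {k : ℕ} (α : Fin k → ℝ) (n : ℕ) (i : Fin k) :
    ((Finset.univ : Finset (Vertex α n)).filter fun v => v.1 = i).card = partSize α n i := by
  have : ((Finset.univ : Finset (Vertex α n)).filter fun v => v.1 = i) =
      (Finset.univ : Finset (Fin (partSize α n i))).map (Function.Embedding.sigmaMk i) := by
    ext ⟨j, x⟩
    simp only [Finset.mem_filter, Finset.mem_univ, true_and, Finset.mem_map,
      Function.Embedding.sigmaMk_apply]
    constructor
    · rintro rfl
      exact ⟨x, rfl⟩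
    · rintro ⟨y, hy⟩
      exact (congrArg Sigma.fst hy).symm
  rw [this, Finset.card_map, Finset.card_fin]

theorem card_vertex_balanced {k : ℕ} (hk : 1 ≤ k) (n : ℕ) :
    Fintype.card (Vertex (balanced k) n) = n := by
  have hk' : (k : ℝ) ≠ 0 := by exact_mod_cast (by omega : k ≠ 0)
  exact card_vertex hk _ (fun i => by unfold balanced; positivity) (by simp [balanced, hk']) n

theorem nonedgeProb_homogeneous {k : ℕ} {p q : I} (hp : (p : ℝ) < 1) (hq : (q : ℝ) < 1)
    (α : Fin k → ℝ) (n : ℕ) (u v : Vertex α n) :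
    nonedgeProb α (homogeneous k p q) (homogeneous_isSymm k p q) n s(u, v) =
      Real.exp (-cost (fun v : Vertex α n => v.1) (-Real.log (1 - p)) (-Real.log (1 - q)) u v) := by
  have hp' : (0 : ℝ) < 1 - p := by linarith
  have hq' : (0 : ℝ) < 1 - q := by linarith
  simp only [nonedgeProb, edgeProb, Sym2.lift_mk, homogeneous, Matrix.of_apply, cost]
  split_ifs <;> simp [Real.exp_log, hp', hq']

/-- With `x` the ratio of `m` to `n * κ / (2 * L)`, the hypothesis reads `1 ≤ x * (1 + η * x)`. At
`x = 1 - η` the right side is `1 - η ^ 2 * (2 - η) < 1`. -/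
theorem le_of_quadratic_bound {n m L κ η : ℝ} (hn : 0 < n) (hm : 0 ≤ m) (hL : 0 < L) (hκ : 0 < κ)
    (hη : 0 < η) (hη1 : η < 1) (h : n ^ 2 * κ ≤ 2 * m * (L * n + m * (2 * η / κ * L ^ 2))) :
    (1 - η) * (n / (2 * L) * κ) ≤ m := by
  by_contra! hlt
  set x := 2 * m * L / (n * κ) with hx
  have hx0 : 0 ≤ x := by positivity
  have hm' : m = x * n * κ / (2 * L) := by rw [hx]; field_simp
  have hx1 : x < 1 - η := by
    rw [hm'] at hlt
    have : x * n * κ / (2 * L) = x * (n / (2 * L) * κ) := by ring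
    rw [this] at hlt
    exact lt_of_mul_lt_mul_right hlt (by positivity)
  have e : 2 * m * (L * n + m * (2 * η / κ * L ^ 2)) = n ^ 2 * κ * (x * (1 + η * x)) := by
    rw [hm']; field_simp
  rw [e] at h
  have h1 : 1 ≤ x * (1 + η * x) := by
    have : 0 < n ^ 2 * κ := by positivity
    exact le_of_mul_le_mul_left (by linarith) this
  have h2 : x * (1 + η * x) ≤ (1 - η) * (1 + η * (1 - η)) := by gcongr
  have h3 : 0 < η * η * (2 - η) := mul_pos (mul_pos hη hη) (by linarith)
  linarith

/-- The main term loses `4 * η`, as `(1 + 4 * η) * (1 - 2 * η) ≥ 1` for `η ≤ 1 / 4`; the three kinds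
of leftover lose `η / 3` each. -/
theorem greedy_bound {k ℓ w : ℕ} {n C L η : ℝ} (hn : 0 < n) (hC : 0 < C) (hL : 0 < L)
    (hη : 0 < η) (hη4 : η ≤ 1 / 4) (hkℓ : (k * ℓ : ℝ) ≤ C * L)
    (hkℓ' : (1 - 2 * η) * (C * L) ≤ k * ℓ) (hw : (w : ℝ) ≤ n / L ^ 3 + 1)
    (h1 : 3 * C ^ 2 ≤ η * L) (h2 : 3 * k * C * L ≤ η * n) (h3 : 6 * C ^ 2 * L ^ 2 ≤ η * n) :
    n / (k * ℓ) + k * (1 + (w * ℓ : ℕ) + ℓ) ≤ (1 + 5 * η) * (n / (C * L)) := by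
  have hCL : 0 < C * L := by positivity
  have hpos : 0 < (1 - 2 * η) * (C * L) := by
    have : 0 < 1 - 2 * η := by linarith
    positivity
  have hA : n / (k * ℓ) ≤ (1 + 4 * η) * (n / (C * L)) := by
    rw [← mul_div_assoc, div_le_div_iff₀ (hpos.trans_le hkℓ') hCL]
    have : C * L ≤ (1 + 4 * η) * (k * ℓ) := by nlinarith
    nlinarith
  have hB : (k : ℝ) * (1 + (w * ℓ : ℕ) + ℓ) ≤ k + (n / L ^ 3 + 1) * (C * L) + C * L := by
    push_cast
    have : (w : ℝ) * (k * ℓ) ≤ (n / L ^ 3 + 1) * (C * L) := by gcongr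
    linarith
  have hc1 : (k : ℝ) ≤ η / 3 * (n / (C * L)) := by
    rw [← mul_div_assoc, le_div_iff₀ hCL]; linarith
  have hc2 : n / L ^ 3 * (C * L) ≤ η / 3 * (n / (C * L)) := by
    rw [← mul_div_assoc, le_div_iff₀ hCL]
    have : n / L ^ 3 * (C * L) * (C * L) = n * C ^ 2 / L := by field_simp
    rw [this, div_le_iff₀ hL]
    nlinarith
  have hc3 : 2 * (C * L) ≤ η / 3 * (n / (C * L)) := by
    rw [← mul_div_assoc, le_div_iff₀ hCL]; linarith
  linarith

/-! ### Choice of parameters and the limit in probability. -/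

theorem eventually_mul_pow_le_exp (c δ : ℝ) (hδ : 0 < δ) (d : ℕ) :
    ∀ᶠ L : ℝ in atTop, c * L ^ d ≤ Real.exp (δ * L) := by
  have h := (isLittleO_pow_exp_pos_mul_atTop d hδ).const_mul_left c
  filter_upwards [h.bound one_pos] with L hL
  rw [one_mul, Real.norm_eq_abs, Real.norm_eq_abs, abs_of_pos (Real.exp_pos _)] at hL
  exact (le_abs_self _).trans hL

/-- The probability that the chromatic number is not within a factor `1 - η` to `1 + 5 * η` of its
asymptotic value. -/
theorem pr_not_chromaticNumber_mem_Icc_le {k : ℕ} (hk : 1 ≤ k) {a b : ℝ} (hb : 0 < b) (hab : b ≤ a) {η : ℝ}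
    (hη : 0 < η) (hη4 : η ≤ 1 / 4) :
    ∀ᶠ n : ℕ in atTop, ∀ r : Sym2 (Vertex (balanced k) n) → ℝ,
      (∀ u v, r s(u, v) = Real.exp (-cost (fun v : Vertex (balanced k) n => v.1) a b u v)) →
      pr r (fun R => ¬ ((1 - η) * (n / (2 * Real.log n) * ((a + (k - 1) * b) / k)) ≤
          ((graphOfNonedges R).chromaticNumber.toNat : ℝ) ∧
        ((graphOfNonedges R).chromaticNumber.toNat : ℝ) ≤
          (1 + 5 * η) * (n / (2 * Real.log n) * ((a + (k - 1) * b) / k)))) ≤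
      Real.exp (-(2 * η / ((a + (k - 1) * b) / k) * Real.log n ^ 2)) * Real.exp (Real.exp (a / 2)) +
        (2 * Real.exp (-1)) ^ n := by
  have ha : 0 < a := hb.trans_le hab
  have hk' : (0 : ℝ) < k := by exact_mod_cast hk
  have hk1 : (0 : ℝ) ≤ k - 1 := sub_nonneg.2 (by exact_mod_cast hk)
  set κ := (a + (k - 1) * b) / k with hκdef
  have hκ : 0 < κ := by positivity
  set C := 2 / κ with hCdef
  have hC : 0 < C := by positivity
  set δ := min (η / 2) (1 / 16)
  have hδ : 0 < δ := lt_min (by positivity) (by norm_num)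
  have hlog : Tendsto (fun n : ℕ => Real.log n) atTop atTop :=
    Real.tendsto_log_atTop.comp tendsto_natCast_atTop_atTop
  have hev := (eventually_gt_atTop (0 : ℝ)).and <| (eventually_ge_atTop (12 * a / η)).and <|
    (eventually_ge_atTop (k / (η * C))).and <| (eventually_ge_atTop (3 * C ^ 2 / η)).and <|
    (eventually_ge_atTop (4 / C)).and <| (eventually_mul_pow_le_exp C δ hδ 4).and <|
    (eventually_mul_pow_le_exp (4 * C) (1 / 2) (by norm_num) 1).and <|
    (eventually_mul_pow_le_exp 4 (1 / 2) (by norm_num) 0).and <|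
    (eventually_mul_pow_le_exp (3 * k * C / η) 1 one_pos 1).and
    (eventually_mul_pow_le_exp (6 * C ^ 2 / η) 1 one_pos 2)
  filter_upwards [hlog.eventually hev, eventually_gt_atTop 0] with n hLs hn r hr
  set L := Real.log n
  obtain ⟨hL, hL1, hL2, hL3, hL4, hL5, hL6, hL7, hL8, hL9⟩ := hLs
  have hn' : (0 : ℝ) < n := by exact_mod_cast hn
  have hexpL : Real.exp L = n := Real.exp_log hn'
  rw [div_le_iff₀ (by positivity)] at hL2 hL3 hL4
  rw [pow_one] at hL6
  rw [pow_zero, mul_one] at hL7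
  rw [pow_one, one_mul, hexpL, div_mul_eq_mul_div, div_le_iff₀ hη] at hL8
  rw [one_mul, hexpL, div_mul_eq_mul_div, div_le_iff₀ hη] at hL9
  have hcard := card_vertex_balanced hk n
  let part : Vertex (balanced k) n → Fin k := fun v => v.1
  set ℓ := ⌊(1 - η) * (C / k) * L⌋₊
  -- Small enough that the `w * ℓ` uncoloured vertices per part are `o(n / L)`, yet large enough
  -- that `k * ℓ / w ≤ n ^ (-(1 - δ))`.
  set w := ⌈(n : ℝ) / L ^ 3⌉₊
  have hη1 : 0 ≤ 1 - η := by linarith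
  have hℓ1 : (k * ℓ : ℝ) ≤ (1 - η) * (C * L) := by
    have : (ℓ : ℝ) ≤ (1 - η) * (C / k) * L := Nat.floor_le (by positivity)
    calc (k * ℓ : ℝ) ≤ k * ((1 - η) * (C / k) * L) := by gcongr
      _ = _ := by field_simp
  have hℓ2 : (1 - 2 * η) * (C * L) ≤ k * ℓ := by
    have : (1 - η) * (C / k) * L < ℓ + 1 := Nat.lt_floor_add_one _
    have h2 : k * ((1 - η) * (C / k) * L) ≤ k * (ℓ + 1 : ℝ) := by gcongr
    have h3 : k * ((1 - η) * (C / k) * L) = (1 - η) * (C * L) := by field_simp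
    nlinarith
  have hℓ3 : (k * ℓ : ℝ) ≤ C * L := hℓ1.trans (by nlinarith [mul_pos hC hL])
  have hkℓ : 2 ≤ k * ℓ := by
    have : (2 : ℝ) ≤ k * ℓ := by nlinarith
    exact_mod_cast this
  have hℓ0 : 0 < ℓ := Nat.pos_of_ne_zero fun h => by simp [h] at hkℓ
  have hw0 : 0 < w := Nat.ceil_pos.2 (by positivity)
  have hw1 : (n : ℝ) / L ^ 3 ≤ w := Nat.le_ceil _
  have hw2 : (w : ℝ) ≤ n / L ^ 3 + 1 := (Nat.ceil_lt_add_one (by positivity)).le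
  have hw0' : (0 : ℝ) < w := by exact_mod_cast hw0
  -- The second moment is small.
  have hM : (ℓ : ℝ) * (a + (k - 1) * b) ≤ 2 * (1 - η) * L := by
    have e : (ℓ : ℝ) * (a + (k - 1) * b) = (k * ℓ) * κ := by rw [hκdef]; field_simp
    rw [e]
    calc (k * ℓ) * κ ≤ (1 - η) * (C * L) * κ := by gcongr
      _ = _ := by rw [hCdef]; field_simp
  have hkw : (k * ℓ : ℝ) / w ≤ Real.exp (-(1 - δ) * L) := by
    have e : Real.exp (-(1 - δ) * L) = Real.exp (δ * L) / n := by
      rw [← hexpL, ← Real.exp_sub]; ring_nf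
    rw [e]
    calc (k * ℓ : ℝ) / w ≤ C * L / (n / L ^ 3) := by gcongr
      _ = C * L ^ 4 / n := by field_simp
      _ ≤ _ := by gcongr
  have hsm := secondMoment_le_of_params ha hL.le hη (min_le_left _ _) (min_le_right _ _) hL1 hM hkw
  have hsm0 : 0 < secondMoment k ℓ w a b := by
    unfold secondMoment
    refine Finset.sum_pos' (fun D _ => by split_ifs <;> positivity)
      ⟨Finset.univ, Finset.mem_univ _, ?_⟩
    have h2 : 2 ≤ (Finset.univ : Finset (Fin k × Fin ℓ)).card := by simpa using hkℓ
    rw [if_pos h2]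
    positivity
  -- The Janson exponent is thus at least `n`, so the union bound over all `U` leaves `(2 / e) ^ n`.
  have hn_le : (n : ℝ) * (2 * secondMoment k ℓ w a b) ≤ 1 := by
    have e : Real.exp (-(3 / 2) * L) = (n * Real.exp (1 / 2 * L))⁻¹ := by
      rw [← hexpL, ← Real.exp_add, ← Real.exp_neg]; ring_nf
    rw [e] at hsm
    have h2 : 2 * ((k * ℓ : ℝ) + 1) ≤ Real.exp (1 / 2 * L) := by linarith
    have hE := Real.exp_pos (1 / 2 * L)
    calc (n : ℝ) * (2 * secondMoment k ℓ w a b)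
        ≤ n * (2 * ((k * ℓ + 1) * (n * Real.exp (1 / 2 * L))⁻¹)) := by gcongr
      _ = 2 * (k * ℓ + 1) / Real.exp (1 / 2 * L) := by field_simp
      _ ≤ 1 := (div_le_one hE).2 h2
  -- The two exceptional events are unlikely.
  have hcost : ∀ u v, 0 ≤ cost part a b u v := fun u v => by
    unfold cost; split_ifs; exacts [ha.le, hb.le]
  have hr0 : ∀ e, 0 ≤ r e := fun e => by
    induction e with | _ u v => rw [hr]; exact (Real.exp_pos _).le
  have hr1 : ∀ e, r e ≤ 1 := fun e => by
    induction e with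
    | _ u v => rw [hr]; exact Real.exp_le_one_iff.2 (neg_nonpos.2 (hcost u v))
  have hlow := pr_exists_high_energy_le ha.le hb.le hr L (2 * η / κ * L ^ 2)
  have hup := pr_exists_no_indep_le ha.le hb.le hab hr hw0 hkℓ
  rw [hcard] at hlow hup
  -- The choice `L = log n` makes the first-moment sum bounded; the decay comes from the slack `2 *
  -- η / κ * L ^ 2`.
  have hlow' : Real.exp (n * Real.exp (a / 2 - L)) = Real.exp (Real.exp (a / 2)) := by
    rw [Real.exp_sub, hexpL, mul_div_cancel₀ _ hn'.ne']
  rw [hlow'] at hlow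
  have hup' : (2 : ℝ) ^ n * Real.exp (-1 / (2 * secondMoment k ℓ w a b)) ≤
      (2 * Real.exp (-1)) ^ n := by
    rw [mul_pow, ← Real.exp_nat_mul]
    gcongr
    rw [mul_neg_one, neg_div]
    exact neg_le_neg ((le_div_iff₀ (by positivity)).2 hn_le)
  -- `true` stands for an independent set of high energy, `false` for a large set without a good
  -- independent set.
  refine (pr_le_sum hr0 hr1 (Finset.univ : Finset Bool) (Q := fun c R => cond c
    (∃ S : Finset (Vertex (balanced k) n), pairs S ⊆ R ∧
      L * S.card + 2 * η / κ * L ^ 2 < energy part a b S / 2)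
    (¬ ∀ U : Finset (Vertex (balanced k) n),
      (∀ i, w * ℓ ≤ (U.filter fun v => part v = i).card) →
      ∃ S ⊆ U, pairs S ⊆ R ∧ ∀ i, (S.filter fun v => part v = i).card = ℓ)) fun R hR => ?_).trans ?_
  · by_contra hcon
    have hc1 : ∀ S : Finset (Vertex (balanced k) n), pairs S ⊆ R →
        energy part a b S / 2 ≤ L * S.card + 2 * η / κ * L ^ 2 := fun S hS =>
      not_lt.1 fun h => hcon ⟨true, Finset.mem_univ _, S, hS, h⟩
    have hc2 := not_not.1 fun h => hcon ⟨false, Finset.mem_univ _, h⟩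
    refine hR ⟨?_, ?_⟩
    · refine le_of_quadratic_bound hn' (Nat.cast_nonneg _) hL hκ hη (by linarith) ?_
      have := sq_card_le_of_coloring (part := part) hb.le hab hk
        (SimpleGraph.colorable_chromaticNumber_of_fintype (graphOfNonedges R)) L
        (2 * η / κ * L ^ 2) fun S hS => hc1 S (pairs_subset_of_isIndepSet hS)
      rwa [hcard] at this
    · have h1 := chromaticNumber_le_of_indep (part := part) (G := graphOfNonedges R) hk hℓ0
        (u := w * ℓ) (fun U hU => by
          obtain ⟨S, hSU, hS, hSi⟩ := hc2 U hU
          exact ⟨S, hSU, isIndepSet_of_pairs_subset hS, hSi⟩)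
        (fun i => by
          rw [hcard, card_filter_part]
          exact div_sub_one_le_partSize hk n i)
      rw [hcard] at h1
      refine h1.trans ((greedy_bound hn' hC hL hη hη4 hℓ3 hℓ2 hw2 (by linarith) (by linarith)
        (by linarith)).trans (le_of_eq ?_))
      rw [hCdef]
      field_simp
  · rw [Fintype.sum_bool]
    exact add_le_add hlow (hup.trans hup')

theorem tendsto_failure_bound {c A : ℝ} (hc : 0 < c) :
    Tendsto (fun n : ℕ => Real.exp (-(c * Real.log n ^ 2)) * A + (2 * Real.exp (-1)) ^ n)
      atTop (𝓝 0) := by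
  have hlog : Tendsto (fun n : ℕ => Real.log n) atTop atTop :=
    Real.tendsto_log_atTop.comp tendsto_natCast_atTop_atTop
  have h1 : Tendsto (fun n : ℕ => Real.exp (-(c * Real.log n ^ 2))) atTop (𝓝 0) :=
    Real.tendsto_exp_neg_atTop_nhds_zero.comp
      (((tendsto_pow_atTop two_ne_zero).comp hlog).const_mul_atTop hc)
  have h2 : Tendsto (fun n : ℕ => (2 * Real.exp (-1)) ^ n) atTop (𝓝 0) := by
    refine tendsto_pow_atTop_nhds_zero_of_lt_one (by positivity) ?_
    rw [Real.exp_neg, ← div_eq_mul_inv, div_lt_one (Real.exp_pos 1)]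
    linarith [Real.exp_one_gt_d9]
  simpa using (h1.mul_const A).add h2

theorem chromaticNumberAsymp_homogeneous {k : ℕ} (hk : 1 ≤ k) {p q : I} (hq : 0 < (q : ℝ))
    (hqp : (q : ℝ) ≤ p) (hp : (p : ℝ) < 1) :
    ChromaticNumberAsymp (balanced k) (homogeneous k p q) (homogeneous_isSymm k p q)
      (fun n => n / (2 * Real.log n) *
        ((-Real.log (1 - p) + ((k : ℝ) - 1) * -Real.log (1 - q)) / k)) := by
  intro ε hε
  have hq1 : (q : ℝ) < 1 := hqp.trans_lt hp
  set a := -Real.log (1 - p)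
  set b := -Real.log (1 - q)
  have hb : 0 < b := neg_pos.2 (Real.log_neg (by linarith) (by linarith))
  have hab : b ≤ a := neg_le_neg (Real.log_le_log (by linarith) (by linarith))
  have ha : 0 < a := hb.trans_le hab
  have hk' : (0 : ℝ) < k := by exact_mod_cast hk
  have hk1 : (0 : ℝ) ≤ k - 1 := sub_nonneg.2 (by exact_mod_cast hk)
  have hκ : 0 < (a + (k - 1) * b) / k := by positivity
  set η := min (ε / 5) (1 / 4)
  have hη : 0 < η := lt_min (by positivity) (by norm_num)
  have hη5 : 5 * η ≤ ε := by linarith [min_le_left (ε / 5) (1 / 4)]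
  refine tendsto_randomBlockGraph_of_pr _ _ _
    (fun n G => |(G.chromaticNumber.toNat : ℝ) - n / (2 * Real.log n) * ((a + (k - 1) * b) / k)| ≤
      ε * |n / (2 * Real.log n) * ((a + (k - 1) * b) / k)|) _
    (tendsto_failure_bound (c := 2 * η / ((a + (k - 1) * b) / k))
      (A := Real.exp (Real.exp (a / 2))) (by positivity)) ?_
  filter_upwards [pr_not_chromaticNumber_mem_Icc_le hk hb hab hη (min_le_right _ _)] with n hn
  refine (pr_mono (nonedgeProb_nonneg _ _ _ n) (nonedgeProb_le_one _ _ _ n)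
    fun R hR hgood => hR ?_).trans
    (hn _ (nonedgeProb_homogeneous hp hq1 _ n))
  have hf : 0 ≤ (n : ℝ) / (2 * Real.log n) * ((a + (k - 1) * b) / k) := by
    have := Real.log_natCast_nonneg n
    positivity
  rw [abs_of_nonneg hf, abs_le]
  constructor <;> nlinarith [hgood.1, hgood.2]

/-! ### The admissible set and the value of `c⋆`. -/

theorem g_homogeneous {k : ℕ} (p q : I) (c : Fin k → ℝ) (J : Finset (Fin k)) :
    g (homogeneous k p q) c J = ∑ i ∈ J, c i -
      ((-Real.log (1 - p) - -Real.log (1 - q)) * ∑ i ∈ J, c i ^ 2 +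
        -Real.log (1 - q) * (∑ i ∈ J, c i) ^ 2) / 2 := by
  have h : ∑ i ∈ J, ∑ j ∈ J, c i * c j * Real.log (1 - (homogeneous k p q i j : ℝ)) =
      (Real.log (1 - p) - Real.log (1 - q)) * ∑ i ∈ J, c i ^ 2 +
        Real.log (1 - q) * (∑ i ∈ J, c i) ^ 2 := by
    rw [sq (∑ i ∈ J, c i), Finset.sum_mul_sum, Finset.mul_sum, Finset.mul_sum,
      ← Finset.sum_add_distrib]
    refine Finset.sum_congr rfl fun i hi => ?_
    have e : ∀ j, c i * c j * Real.log (1 - (homogeneous k p q i j : ℝ)) =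
        (if i = j then c i * c j * (Real.log (1 - p) - Real.log (1 - q)) else 0) +
          Real.log (1 - q) * (c i * c j) := by
      intro j
      simp only [homogeneous, Matrix.of_apply]
      split_ifs <;> ring
    simp only [e, Finset.sum_add_distrib, Finset.sum_ite_eq, hi, if_true, ← Finset.mul_sum]
    ring
  rw [g, h]
  ring

/-- Each `g(·, J)` is concave: the defect of a convex combination is `s * t` times a nonnegative
form in `c - d`, because `0 ≤ b ≤ a`. -/
theorem convex_admissible_homogeneous {k : ℕ} {p q : I} (hqp : (q : ℝ) ≤ p) (hp : (p : ℝ) < 1) :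
    Convex ℝ (admissible (homogeneous k p q)) := by
  have hb : 0 ≤ -Real.log (1 - q) :=
    neg_nonneg.2 (Real.log_nonpos (by linarith) (by linarith [q.2.1]))
  have hab : 0 ≤ -Real.log (1 - p) - -Real.log (1 - q) := by
    have := Real.log_le_log (x := 1 - (p : ℝ)) (y := 1 - q) (by linarith) (by linarith)
    linarith
  rintro c ⟨hc0, hc⟩ d ⟨hd0, hd⟩ s t hs ht hst
  refine ⟨fun i => ?_, fun J hJ => ?_⟩
  · have := hc0 i
    have := hd0 i
    simp only [Pi.add_apply, Pi.smul_apply, smul_eq_mul]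
    positivity
  have h1 := hc J hJ
  have h2 := hd J hJ
  rw [g_homogeneous] at h1 h2 ⊢
  simp only [Pi.add_apply, Pi.smul_apply, smul_eq_mul, Finset.sum_add_distrib, ← Finset.mul_sum]
  have hX : ∑ i ∈ J, (s * c i + t * d i) ^ 2 =
      s * ∑ i ∈ J, c i ^ 2 + t * ∑ i ∈ J, d i ^ 2 - s * t * ∑ i ∈ J, (c i - d i) ^ 2 := by
    rw [Finset.mul_sum, Finset.mul_sum, Finset.mul_sum, ← Finset.sum_add_distrib,
      ← Finset.sum_sub_distrib]
    refine Finset.sum_congr rfl fun i _ => ?_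
    obtain rfl : t = 1 - s := by linarith
    ring
  have hY : ∀ x y : ℝ, (s * x + t * y) ^ 2 = s * x ^ 2 + t * y ^ 2 - s * t * (x - y) ^ 2 := by
    intro x y
    obtain rfl : t = 1 - s := by linarith
    ring
  rw [hX, hY]
  have e1 := mul_nonneg hs h1
  have e2 := mul_nonneg ht h2
  have e3 : 0 ≤ (-Real.log (1 - p) - -Real.log (1 - q)) *
      (s * t * ∑ i ∈ J, (c i - d i) ^ 2) :=
    mul_nonneg hab (mul_nonneg (mul_nonneg hs ht) (Finset.sum_nonneg fun i _ => sq_nonneg _))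
  have e4 : 0 ≤ -Real.log (1 - q) * (s * t * (∑ i ∈ J, c i - ∑ i ∈ J, d i) ^ 2) :=
    mul_nonneg hb (mul_nonneg (mul_nonneg hs ht) (sq_nonneg _))
  linarith

/-- For `t ≥ 0` the sign depends on `J` only through a mean cost that grows with `J.card`, so `J =
univ` is the binding constraint on this ray. -/
theorem g_smul_balanced {k : ℕ} (hk : 1 ≤ k) (p q : I) (t : ℝ) (J : Finset (Fin k)) :
    g (homogeneous k p q) (t • balanced k) J = J.card * t / k * (1 - t / 2 *
      ((-Real.log (1 - p) + ((J.card : ℝ) - 1) * -Real.log (1 - q)) / k)) := by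
  have hk' : (k : ℝ) ≠ 0 := by exact_mod_cast (by omega : k ≠ 0)
  rw [g_homogeneous]
  simp only [Pi.smul_apply, balanced, smul_eq_mul, Finset.sum_const, nsmul_eq_mul]
  field_simp
  ring

theorem sum_abs_smul_balanced {k : ℕ} (hk : 1 ≤ k) {t : ℝ} (ht : 0 ≤ t) :
    ∑ i, |(t • balanced k) i| = t := by
  have hk' : (0 : ℝ) < k := by exact_mod_cast hk
  simp only [Pi.smul_apply, balanced, smul_eq_mul, Finset.sum_const, nsmul_eq_mul,
    Finset.card_univ, Fintype.card_fin]
  rw [abs_of_nonneg (by positivity)]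
  field_simp

section Extremal

variable {k : ℕ} (hk : 1 ≤ k) {p q : I} (hq : 0 < (q : ℝ)) (hqp : (q : ℝ) ≤ p) (hp : (p : ℝ) < 1)

include hk hq hqp hp

theorem mean_cost_pos :
    0 < (-Real.log (1 - p) + ((k : ℝ) - 1) * -Real.log (1 - q)) / k := by
  have hk' : (0 : ℝ) < k := by exact_mod_cast hk
  have hk1 : (0 : ℝ) ≤ k - 1 := sub_nonneg.2 (by exact_mod_cast hk)
  have hb : 0 < -Real.log (1 - q) := neg_pos.2 (Real.log_neg (by linarith) (by linarith))
  have ha : 0 < -Real.log (1 - p) := neg_pos.2 (Real.log_neg (by linarith) (by linarith))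
  positivity

theorem smul_balanced_mem_admissible :
    (2 / ((-Real.log (1 - p) + ((k : ℝ) - 1) * -Real.log (1 - q)) / k)) • balanced k ∈
      admissible (homogeneous k p q) := by
  have hκ := mean_cost_pos hk hq hqp hp
  have hk' : (0 : ℝ) < k := by exact_mod_cast hk
  have hb : 0 < -Real.log (1 - q) := neg_pos.2 (Real.log_neg (by linarith) (by linarith))
  set κ := (-Real.log (1 - p) + ((k : ℝ) - 1) * -Real.log (1 - q)) / k with hκdef
  refine ⟨fun i => ?_, fun J _ => ?_⟩
  · simp only [Pi.smul_apply, balanced, smul_eq_mul]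
    positivity
  · rw [g_smul_balanced hk]
    refine mul_nonneg (by positivity) (sub_nonneg.2 ?_)
    have hJ : (J.card : ℝ) ≤ k := by exact_mod_cast (by simpa using Finset.card_le_univ J)
    have hle : (-Real.log (1 - p) + ((J.card : ℝ) - 1) * -Real.log (1 - q)) / k ≤ κ := by
      rw [hκdef]; gcongr
    calc _ ≤ 2 / κ / 2 * κ := by gcongr
      _ = 1 := by field_simp

theorem isGreatest_admissibleNorms :
    IsGreatest (admissibleNorms (balanced k) (homogeneous k p q))
      (2 / ((-Real.log (1 - p) + ((k : ℝ) - 1) * -Real.log (1 - q)) / k)) := by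
  have hκ := mean_cost_pos hk hq hqp hp
  have hmem := smul_balanced_mem_admissible hk hq hqp hp
  have hk' : (0 : ℝ) < k := by exact_mod_cast hk
  set κ := (-Real.log (1 - p) + ((k : ℝ) - 1) * -Real.log (1 - q)) / k with hκdef
  have hC : 0 < 2 / κ := by positivity
  rw [admissibleNorms, (convex_admissible_homogeneous hqp hp).convexHull_eq]
  refine ⟨⟨_, ⟨hmem, _, hC.le, rfl⟩, sum_abs_smul_balanced hk hC.le⟩, ?_⟩
  rintro _ ⟨_, ⟨⟨-, hc⟩, t, ht, rfl⟩, rfl⟩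
  simp only [sum_abs_smul_balanced hk ht]
  have : Nonempty (Fin k) := ⟨⟨0, hk⟩⟩
  have h := hc Finset.univ Finset.univ_nonempty
  rw [g_smul_balanced hk, Finset.card_univ, Fintype.card_fin, ← hκdef,
    mul_div_assoc, mul_div_cancel₀ _ hk'.ne'] at h
  by_contra! hlt
  have ht' : 0 < t := hC.trans hlt
  rw [div_lt_iff₀ hκ] at hlt
  have := nonneg_of_mul_nonneg_right h ht'
  linarith

end Extremal

end BlockModel

end

theorem mainTheorem3 (k : ℕ) (hk : 1 ≤ k) (p q : unitInterval)
    (hq : 0 < (q : ℝ)) (hqp : (q : ℝ) ≤ (p : ℝ)) (hp : (p : ℝ) < 1) :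
    Convex ℝ (BlockModel.admissible (BlockModel.homogeneous k p q)) ∧
    IsGreatest
      (BlockModel.admissibleNorms (BlockModel.balanced k) (BlockModel.homogeneous k p q))
      (-2 / (1 / (k : ℝ) * Real.log (1 - p) + ((k : ℝ) - 1) / k * Real.log (1 - q))) ∧
    BlockModel.cStar (BlockModel.balanced k) (BlockModel.homogeneous k p q) =
      -2 / (1 / (k : ℝ) * Real.log (1 - p) + ((k : ℝ) - 1) / k * Real.log (1 - q)) ∧
    BlockModel.cStar (BlockModel.balanced k) (BlockModel.homogeneous k p q) •
        BlockModel.balanced k ∈ BlockModel.admissible (BlockModel.homogeneous k p q) ∧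
    BlockModel.ChromaticNumberAsymp (BlockModel.balanced k) (BlockModel.homogeneous k p q)
      (BlockModel.homogeneous_isSymm k p q)
      (fun n => n /
        (BlockModel.cStar (BlockModel.balanced k) (BlockModel.homogeneous k p q) *
          Real.log n)) ∧
    BlockModel.ChromaticNumberAsymp (BlockModel.balanced k) (BlockModel.homogeneous k p q)
      (BlockModel.homogeneous_isSymm k p q)
      (fun n => n / (2 * Real.log n) *
        (-(1 / (k : ℝ)) * Real.log (1 - p) - ((k : ℝ) - 1) / k * Real.log (1 - q))) := by
  have hκ := BlockModel.mean_cost_pos hk hq hqp hp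
  have hgreatest := BlockModel.isGreatest_admissibleNorms hk hq hqp hp
  have hmem := BlockModel.smul_balanced_mem_admissible hk hq hqp hp
  have hχ := BlockModel.chromaticNumberAsymp_homogeneous hk hq hqp hp
  have hneg : 1 / (k : ℝ) * Real.log (1 - p) + ((k : ℝ) - 1) / k * Real.log (1 - q) =
      -((-Real.log (1 - p) + ((k : ℝ) - 1) * -Real.log (1 - q)) / k) := by ring
  have hpos : -(1 / (k : ℝ)) * Real.log (1 - p) - ((k : ℝ) - 1) / k * Real.log (1 - q) =
      (-Real.log (1 - p) + ((k : ℝ) - 1) * -Real.log (1 - q)) / k := by ring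
  have hcStar : BlockModel.cStar (BlockModel.balanced k) (BlockModel.homogeneous k p q) =
      2 / ((-Real.log (1 - p) + ((k : ℝ) - 1) * -Real.log (1 - q)) / k) := hgreatest.csSup_eq
  rw [hneg, hpos, neg_div_neg_eq, hcStar]
  refine ⟨BlockModel.convex_admissible_homogeneous hqp hp, hgreatest, rfl, hmem, ?_, hχ⟩
  convert hχ using 2 with n
  generalize (-Real.log (1 - p) + ((k : ℝ) - 1) * -Real.log (1 - q)) / k = κ at hκ
  -- For `n ≤ 1` the logarithm vanishes and both expressions are `0`, since division by zero gives
  -- `0`.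
  rcases eq_or_ne (Real.log n) 0 with h | h
  · simp [h]
  · field_simp
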